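/- All graphs are finite and simple. Given a (not necessarily proper) vertex-coloring of a connected graph $G$, a path is called vertex-monochromatic if all its internal vertices have the same color; the coloring is an MVC-coloring if any two vertices of $G$ are joined by a vertex-monochromatic path. Let $mvc(G)$ denote the maximum number of colors used in an MVC-coloring of $G$. Let $n\ge 3$, $1\le t\le n-2$ and $m$ be integers with $$n+\binom{t}{2}\;\le\; m\;\le\; n+\binom{t+1}{2}-1 .$$ Call $(n,m,t)$ exceptional if $m=n+\binom{t+1}{2}-1$ and $t\in\{n-3,\,n-4\}$. 1. Every connected graph $G$ with $n$ vertices and $m$ edges satisfies $mvc(G)\ge t+2$. If $(n,m,t)$ is not exceptional, this bound is sharp: there is a connected graph $G$ with $n$ vertices and $m$ edges such that $mvc(G)=t+2$. 2. If $(n,m,t)$ is exceptional, then every connected graph $G$ with $n$ vertices and $m$ edges satisfies $mvc(G)\ge t+3$, and this bound is sharp: there is a connected graph $G$ with $n$ vertices and $m$ edges such that $mvc(G)=t+3$. -/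

import Mathlib

namespace SimpleGraph

/-- A walk is vertex-monochromatic with respect to the vertex-coloring `f` if all of its internal
vertices (for a path: the vertices on it other than its two ends) have the same color. -/
def Walk.IsVertexMonochromatic {V α : Type*} {G : SimpleGraph V} (f : V → α) {u v : V}
    (p : G.Walk u v) : Prop :=
  ∀ x ∈ p.support, ∀ y ∈ p.support, x ≠ u → x ≠ v → y ≠ u → y ≠ v → f x = f y

/-- `f` is an MVC-coloring of `G` (not necessarily a proper coloring): any two vertices are joined
by a vertex-monochromatic path. -/
def IsMVCColoring {V α : Type*} (G : SimpleGraph V) (f : V → α) : Prop :=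
  ∀ u v : V, u ≠ v → ∃ p : G.Walk u v, p.IsPath ∧ p.IsVertexMonochromatic f

/-- The monochromatic vertex-connection number: the maximum number of colors used in an
MVC-coloring of `G`. A coloring that uses exactly `k` colors is a surjection onto `Fin k`. -/
noncomputable def mvc {V : Type*} (G : SimpleGraph V) : ℕ :=
  sSup {k : ℕ | ∃ f : V → Fin k, Function.Surjective f ∧ G.IsMVCColoring f}

/-- For a finite connected graph the supremum in the definition of `mvc` is a maximum. -/
theorem isGreatest_mvc {V : Type*} [Finite V] (G : SimpleGraph V) (hG : G.Connected) :
    IsGreatest {k : ℕ | ∃ f : V → Fin k, Function.Surjective f ∧ G.IsMVCColoring f} G.mvc := by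
  have hbdd : BddAbove {k : ℕ | ∃ f : V → Fin k, Function.Surjective f ∧ G.IsMVCColoring f} := by
    refine ⟨Nat.card V, ?_⟩
    rintro k ⟨f, hf, -⟩
    simpa using Nat.card_le_card_of_surjective f hf
  refine ⟨Nat.sSup_mem ⟨1, fun _ => 0, ?_, ?_⟩ hbdd, fun k hk => le_csSup hbdd hk⟩
  · obtain ⟨v⟩ := hG.nonempty
    exact fun c => ⟨v, Subsingleton.elim _ _⟩
  · intro u v _
    obtain ⟨p, hp⟩ := hG.exists_isPath u v
    exact ⟨p, hp, fun _ _ _ _ _ _ _ _ => rfl⟩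

end SimpleGraph

/-!
The lower bounds rest on a theorem of Ding, Johnson and Seymour: a connected graph with `n` vertices
and at least `n + t.choose 2` edges, where `n ≠ t + 2`, has a spanning tree with more than `t`
leaves. It is used in the following form: some connected vertex set `D` has more than `t` vertices on
its outer boundary (`edgeBound`). Extending `D` to a connected dominating set keeps the boundary
large, and giving one colour to the dominating set and distinct colours to all other vertices is an
MVC-colouring with at least `t + 2` colours (`GrowsFrom.card_outerBoundary_lt_mvc`).

The proof of `edgeBound` is an induction on the number of vertices. Let all boundaries of connected
sets have at most `t` vertices. Deleting a vertex and making its neighbourhood a clique (`eliminate`)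
preserves this, so in a minimal counterexample with at least `t + 4` vertices every neighbourhood is
nearly complete. Let `v` have maximum degree `d ≤ t`. If `d = t`, every neighbour of `v` has at most
one neighbour far from `v`, and the boundaries of two-element sets show that the neighbours of `v`
with a far neighbour are linked in the complement of the neighbourhood of `v`; this yields enough
missing edges (`pairCount_le_of_degree_eq`). If `d < t`, the edges leaving the neighbourhood of `v`
are compensated by missing edges inside it, and the components of the far part satisfy the edge bound
by induction with parameters whose excesses over `2` add up to at most `t - d`
(`pairCount_le_of_degree_lt`).

If `n = t + 2`, or in the exceptional case `n = t + 3`, the number of edges forces diameter at most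
two, and then every colouring is an MVC-colouring. In the exceptional case `n = t + 4`, a graph of
larger diameter has a dominating edge (`Connected.card_sub_one_le_mvc`).

For sharpness, `mvc` is monotone under adding edges, so it is enough to bound it for one connected
graph with sufficiently many edges and to pass to a connected spanning subgraph with exactly `m`
edges. For `n ≤ t + 4` that graph is complete or a clique with a path attached (`tailGraph`), in which
the two vertices farthest apart force a long monochromatic path. For `n ≥ t + 5` it is a clique on
`t + 2` vertices with one edge subdivided (`earGraph`), where an MVC-colouring uses at most two
colours on the long path beyond those of the other clique vertices (`HasEar.exists_two`).
-/

namespace SimpleGraph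

open Finset
open scoped Classical

/-! ### Connected vertex sets and their boundaries -/

section

/-- `G.GrowsFrom r D`: the finite vertex set `D` arises from `{r}` by adding, one at a time, vertices
adjacent to a vertex already present. Equivalently `r ∈ D` and `D` induces a connected subgraph; the
inductive form gives a convenient induction principle. -/
inductive GrowsFrom {V : Type*} [DecidableEq V] (G : SimpleGraph V) (r : V) : Finset V → Prop
  | single : G.GrowsFrom r {r}
  | grow {D : Finset V} {u w : V} :
      G.GrowsFrom r D → u ∈ D → G.Adj u w → G.GrowsFrom r (insert w D)

namespace GrowsFrom

variable {V W : Type*} [DecidableEq V] [DecidableEq W] {G : SimpleGraph V} {r : V} {D E : Finset V}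

lemma root_mem (h : G.GrowsFrom r D) : r ∈ D := by
  induction h with
  | single => simp
  | grow _ _ _ ih => exact mem_insert_of_mem ih

lemma pair {a b : V} (h : G.Adj a b) : G.GrowsFrom a {b, a} :=
  GrowsFrom.grow .single (mem_singleton_self a) h

lemma union {k w : V} (hD : G.GrowsFrom r D) (hE : G.GrowsFrom k E) (hw : w ∈ D)
    (hwk : G.Adj w k) : G.GrowsFrom r (D ∪ E) := by
  induction hE with
  | single => rw [union_comm, ← insert_eq]; exact hD.grow hw hwk
  | grow _ hu hadj ih => rw [union_insert]; exact ih.grow (mem_union_right _ hu) hadj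

/-- Every vertex of a connected set can serve as its root. -/
lemma reroot {k : V} (hD : G.GrowsFrom r D) (hk : k ∈ D) : G.GrowsFrom k D := by
  induction hD generalizing k with
  | single => rw [mem_singleton.1 hk]; exact .single
  | grow _ hu hadj ih =>
    rcases mem_insert.1 hk with rfl | hk
    · rw [insert_eq]
      exact GrowsFrom.single.union (ih hu) (mem_singleton_self _) hadj.symm
    · obtain h := ih hk
      exact h.grow hu hadj

lemma map {H : SimpleGraph W} (φ : G →g H) (hD : G.GrowsFrom r D) :
    H.GrowsFrom (φ r) (D.image φ) := by
  induction hD with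
  | single => simpa using GrowsFrom.single
  | grow _ hu hadj ih =>
    rw [image_insert]; exact ih.grow (mem_image_of_mem _ hu) (φ.map_adj hadj)

/-- A set that splits a connected set `D` is crossed by an edge inside `D`. -/
lemma exists_adj_crossing (hD : G.GrowsFrom r D) {S : Set V} (h₁ : ∃ a ∈ D, a ∈ S)
    (h₂ : ∃ b ∈ D, b ∉ S) : ∃ a ∈ D, ∃ b ∈ D, a ∈ S ∧ b ∉ S ∧ G.Adj a b := by
  induction hD with
  | single => grind
  | @grow D u w _ hu hadj ih =>
    by_cases h₃ : ∃ a ∈ D, a ∈ S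
    · by_cases h₄ : ∃ b ∈ D, b ∉ S
      · obtain ⟨a, ha, b, hb, h⟩ := ih h₃ h₄
        exact ⟨a, mem_insert_of_mem ha, b, mem_insert_of_mem hb, h⟩
      · have := hadj.symm; grind
    · have := hadj.symm; grind

lemma exists_walk (hD : G.GrowsFrom r D) {a : V} (ha : a ∈ D) :
    ∃ p : G.Walk r a, ∀ x ∈ p.support, x ∈ D := by
  induction hD generalizing a with
  | single =>
    obtain rfl := mem_singleton.1 ha
    exact ⟨.nil, by simp⟩
  | @grow D u w _ hu hadj ih =>
    rcases mem_insert.1 ha with rfl | ha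
    · obtain ⟨p, hp⟩ := ih hu
      refine ⟨p.concat hadj, fun x hx => ?_⟩
      rw [Walk.support_concat, List.mem_append] at hx
      rcases hx with hx | hx
      · exact mem_insert_of_mem (hp x hx)
      · rw [List.mem_singleton.1 hx]; exact mem_insert_self _ _
    · obtain ⟨p, hp⟩ := ih ha
      exact ⟨p, fun x hx => mem_insert_of_mem (hp x hx)⟩

end GrowsFrom

section Crossing

variable {V : Type*} {G : SimpleGraph V}

lemma Connected.exists_adj_crossing (hG : G.Connected) {S : Set V} {x y : V} (hx : x ∈ S)
    (hy : y ∉ S) : ∃ a ∈ S, ∃ b ∉ S, G.Adj a b := by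
  obtain ⟨p⟩ := hG.preconnected x y
  obtain ⟨d, -, h₁, h₂⟩ := p.exists_boundary_dart S hx hy
  exact ⟨d.fst, h₁, d.snd, h₂, d.adj⟩

lemma connected_of_exists_adj_crossing [Nonempty V]
    (h : ∀ (S : Set V) (x y : V), x ∈ S → y ∉ S → ∃ a ∈ S, ∃ b ∉ S, G.Adj a b) :
    G.Connected := by
  rw [connected_iff]
  refine ⟨fun x y => ?_, inferInstance⟩
  by_contra hxy
  obtain ⟨a, ha, b, hb, hab⟩ := h {z | G.Reachable x z} x y (Reachable.refl x) hxy
  exact hb (ha.trans hab.reachable)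

end Crossing

variable {V : Type*} [Fintype V] [DecidableEq V] (G : SimpleGraph V)

/-- The outer boundary of `D`: the vertices outside `D` with a neighbour in `D`. -/
noncomputable def outerBoundary (D : Finset V) : Finset V := {x | x ∉ D ∧ ∃ u ∈ D, G.Adj u x}

variable {G}

@[simp] lemma mem_outerBoundary {D : Finset V} {x : V} :
    x ∈ G.outerBoundary D ↔ x ∉ D ∧ ∃ u ∈ D, G.Adj u x := by
  simp [outerBoundary]

/-- A connected set extends to a connected dominating set without shrinking the boundary: a boundary
vertex with a neighbour not yet dominated may always be added. -/
lemma GrowsFrom.exists_dominating (hG : G.Connected) {r : V} {D : Finset V}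
    (hD : G.GrowsFrom r D) : ∃ E, G.GrowsFrom r E ∧ D ⊆ E ∧
      #(G.outerBoundary D) ≤ #(G.outerBoundary E) ∧ ∀ x, x ∈ E ∨ x ∈ G.outerBoundary E := by
  let F : Finset (Finset V) := {E | G.GrowsFrom r E ∧ D ⊆ E ∧
      #(G.outerBoundary D) ≤ #(G.outerBoundary E)}
  obtain ⟨E, hE, hmax⟩ := F.exists_max_image card ⟨D, by simp [F, hD]⟩
  simp only [F, mem_filter, mem_univ, true_and] at hE hmax
  refine ⟨E, hE.1, hE.2.1, hE.2.2, ?_⟩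
  by_contra! hx
  obtain ⟨x, hx⟩ := hx
  obtain ⟨a, ha, b, hb, hab⟩ := hG.exists_adj_crossing (S := {x | x ∈ E ∨ x ∈ G.outerBoundary E})
    (x := r) (y := x) (Or.inl hE.1.root_mem) (by simpa using hx)
  simp only [Set.mem_ofPred_eq, mem_outerBoundary, not_or, not_and, not_exists] at ha hb
  have haE : a ∉ E := fun h => hb.2 hb.1 a h hab
  obtain ⟨-, u, hu, hua⟩ := ha.resolve_left haE
  have key := hmax (insert a E) ⟨hE.1.grow hu hua, hE.2.1.trans (subset_insert _ _), ?_⟩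
  · rw [card_insert_of_notMem haE] at key
    lia
  · refine hE.2.2.trans ?_
    have hsub : insert b ((G.outerBoundary E).erase a) ⊆ G.outerBoundary (insert a E) := by
      intro y hy
      have := hab.ne'
      simp only [mem_insert, mem_erase, mem_outerBoundary] at hy ⊢
      grind
    have h₁ : b ∉ (G.outerBoundary E).erase a := by
      simp only [mem_erase, mem_outerBoundary]; grind
    have h₂ : a ∈ G.outerBoundary E := mem_outerBoundary.2 ⟨haE, u, hu, hua⟩
    have h₃ := card_le_card hsub
    rw [card_insert_of_notMem h₁, card_erase_of_mem h₂] at h₃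
    have := card_pos.2 ⟨a, h₂⟩
    lia

/-- Forcing a prescribed vertex into a connected set costs at most one boundary vertex. -/
lemma GrowsFrom.exists_root (hG : G.Connected) {r : V} {D : Finset V} (hD : G.GrowsFrom r D)
    (k : V) : ∃ E, G.GrowsFrom k E ∧ #(G.outerBoundary D) ≤ #(G.outerBoundary E) + 1 := by
  obtain ⟨E, hE, -, hle, hdom⟩ := hD.exists_dominating hG
  rcases hdom k with hk | hk
  · exact ⟨E, hE.reroot hk, by lia⟩
  · obtain ⟨h₁, u, hu, huk⟩ := mem_outerBoundary.1 hk
    refine ⟨insert k E, (hE.grow hu huk).reroot (mem_insert_self _ _), ?_⟩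
    have : (G.outerBoundary E).erase k ⊆ G.outerBoundary (insert k E) := by
      intro y hy
      simp only [mem_insert, mem_erase, mem_outerBoundary] at hy ⊢
      grind
    have := card_le_card this
    rw [card_erase_of_mem hk] at this
    lia

end

/-! ### Lower bounds for `mvc` -/

section

variable {V : Type*} [Fintype V] {G : SimpleGraph V}

lemma le_mvc_of_surjective {k : ℕ} {f : V → Fin k} (hf : Function.Surjective f)
    (h : G.IsMVCColoring f) : k ≤ G.mvc := by
  refine le_csSup ⟨Fintype.card V, ?_⟩ ⟨f, hf, h⟩
  rintro l ⟨g, hg, -⟩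
  simpa using Fintype.card_le_of_surjective g hg

lemma mvc_le_card : G.mvc ≤ Fintype.card V := by
  refine csSup_le' ?_
  rintro l ⟨g, hg, -⟩
  simpa using Fintype.card_le_of_surjective g hg

/-- A connected dominating set may be coloured with one colour and all other vertices with distinct
colours. -/
lemma GrowsFrom.card_outerBoundary_lt_mvc_of_dominating [DecidableEq V] {r : V} {D : Finset V}
    (hD : G.GrowsFrom r D) (hdom : ∀ x, x ∈ D ∨ x ∈ G.outerBoundary D) :
    #(G.outerBoundary D) + 1 ≤ G.mvc := by
  set B := G.outerBoundary D with hB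
  let e := B.equivFin
  let f : V → Fin (#B + 1) := fun x => if h : x ∈ B then (e ⟨x, h⟩).castSucc else Fin.last _
  have hfD : ∀ x ∈ D, f x = Fin.last _ := by
    intro x hx
    have : x ∉ B := by simp [hB, hx]
    simp [f, this]
  refine le_mvc_of_surjective (f := f) (fun c => ?_) (fun u v huv => ?_)
  · induction c using Fin.lastCases with
    | last => exact ⟨r, hfD r hD.root_mem⟩
    | cast i => exact ⟨(e.symm i).1, by simp [f]⟩
  · -- both ends are linked to `D` by a walk all of whose further vertices lie in `D`
    have key : ∀ u, ∃ p : G.Walk r u, ∀ x ∈ p.support, x = u ∨ x ∈ D := by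
      intro u
      rcases hdom u with hu | hu
      · obtain ⟨p, hp⟩ := hD.exists_walk hu
        exact ⟨p, fun x hx => Or.inr (hp x hx)⟩
      · obtain ⟨-, w, hw, hadj⟩ := mem_outerBoundary.1 hu
        obtain ⟨p, hp⟩ := hD.exists_walk hw
        refine ⟨p.concat hadj, fun x hx => ?_⟩
        rw [Walk.support_concat, List.mem_append] at hx
        rcases hx with hx | hx
        · exact Or.inr (hp x hx)
        · exact Or.inl (List.mem_singleton.1 hx)
    obtain ⟨p, hp⟩ := key u
    obtain ⟨q, hq⟩ := key v
    have hsub : ∀ x ∈ ((p.reverse.append q).bypass).support, x ≠ u → x ≠ v → x ∈ D := by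
      intro x hx hxu hxv
      have hx := Walk.support_bypass_subset_support _ hx
      rw [Walk.mem_support_append_iff, Walk.support_reverse, List.mem_reverse] at hx
      rcases hx with hx | hx
      · exact (hp x hx).resolve_left hxu
      · exact (hq x hx).resolve_left hxv
    refine ⟨(p.reverse.append q).bypass, Walk.bypass_isPath _, ?_⟩
    intro x hx y hy hxu hxv hyu hyv
    rw [hfD x (hsub x hx hxu hxv), hfD y (hsub y hy hyu hyv)]

lemma GrowsFrom.card_outerBoundary_lt_mvc [DecidableEq V] (hG : G.Connected) {r : V} {D : Finset V}
    (hD : G.GrowsFrom r D) : #(G.outerBoundary D) + 1 ≤ G.mvc := by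
  obtain ⟨E, hE, -, hle, hdom⟩ := hD.exists_dominating hG
  have := hE.card_outerBoundary_lt_mvc_of_dominating hdom
  lia

/-- In a graph of diameter at most two every colouring is an MVC-colouring. -/
lemma card_le_mvc_of_forall_adj_or_common
    (h : ∀ u v, u ≠ v → G.Adj u v ∨ ∃ w, G.Adj u w ∧ G.Adj w v) : Fintype.card V ≤ G.mvc := by
  refine le_mvc_of_surjective (f := Fintype.equivFin V) (Fintype.equivFin V).surjective ?_
  intro u v huv
  rcases h u v huv with h | ⟨w, h₁, h₂⟩
  · refine ⟨h.toWalk, by simp [h.ne], ?_⟩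
    intro x hx y hy hxu hxv
    simp at hx
    grind
  · refine ⟨.cons h₁ h₂.toWalk, by simp [h₂.ne, h₁.ne, huv], ?_⟩
    intro x hx y hy hxu hxv hyu hyv
    simp at hx hy
    grind

end

/-! ### Counting adjacent pairs -/

section

section PairCount

variable {V : Type*} (G : SimpleGraph V)

/-- The number of ordered pairs in `A × B` that are adjacent in `G`, as an integer. In particular
`G.pairCount univ univ` is twice the number of edges. -/
noncomputable def pairCount (A B : Finset V) : ℤ := ∑ a ∈ A, ∑ b ∈ B, if G.Adj a b then 1 else 0

variable {G} {A B C : Finset V}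

lemma pairCount_comm : G.pairCount A B = G.pairCount B A := by
  unfold pairCount
  rw [sum_comm]
  simp_rw [G.adj_comm]

lemma pairCount_nonneg : 0 ≤ G.pairCount A B :=
  sum_nonneg fun _ _ => sum_nonneg fun _ _ => by split_ifs <;> simp

lemma pairCount_mono {A' B' : Finset V} (hA : A ⊆ A') (hB : B ⊆ B') :
    G.pairCount A B ≤ G.pairCount A' B' := by
  refine (sum_le_sum fun a _ => sum_le_sum_of_subset_of_nonneg hB ?_).trans
    (sum_le_sum_of_subset_of_nonneg hA ?_)
  · intros; split_ifs <;> simp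
  · exact fun _ _ _ => sum_nonneg fun _ _ => by split_ifs <;> simp

lemma pairCount_eq_sum_card :
    G.pairCount A B = ∑ a ∈ A, (#{b ∈ B | G.Adj a b} : ℤ) := by
  simp [pairCount, sum_boole]

lemma pairCount_singleton_left {a : V} : G.pairCount {a} B = #{b ∈ B | G.Adj a b} := by
  simp [pairCount_eq_sum_card]

lemma pairCount_singleton_self {a : V} : G.pairCount {a} {a} = 0 := by
  simp [pairCount]

lemma pairCount_eq_zero (h : ∀ a ∈ A, ∀ b ∈ B, ¬ G.Adj a b) : G.pairCount A B = 0 :=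
  sum_eq_zero fun a ha => sum_eq_zero fun b hb => by simp [h a ha b hb]

lemma pairCount_le_mul {c : ℤ} (h : ∀ a ∈ A, (#{b ∈ B | G.Adj a b} : ℤ) ≤ c) :
    G.pairCount A B ≤ #A * c := by
  rw [pairCount_eq_sum_card]
  simpa using sum_le_card_nsmul A _ c h

variable [DecidableEq V]

lemma pairCount_union_left (h : Disjoint A B) :
    G.pairCount (A ∪ B) C = G.pairCount A C + G.pairCount B C := sum_union h

lemma pairCount_union_right (h : Disjoint A B) :
    G.pairCount C (A ∪ B) = G.pairCount C A + G.pairCount C B := by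
  rw [pairCount_comm, pairCount_union_left h, pairCount_comm, pairCount_comm (A := B)]

lemma pairCount_union_self (h : Disjoint A B) :
    G.pairCount (A ∪ B) (A ∪ B) = G.pairCount A A + 2 * G.pairCount A B + G.pairCount B B := by
  rw [pairCount_union_left h, pairCount_union_right h, pairCount_union_right h,
    pairCount_comm (A := B) (B := A)]
  ring

lemma pairCount_self_le : G.pairCount A A ≤ #A * (#A - 1) := by
  refine pairCount_le_mul fun a ha => ?_
  have : #{b ∈ A | G.Adj a b} ≤ #(A.erase a) :=
    card_le_card fun b hb => by
      have := (mem_filter.1 hb).2.ne'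
      grind
  have h := card_erase_add_one ha
  lia

/-- The non-adjacency graph of `G` on the vertex set `A`. -/
def nonadjOn (G : SimpleGraph V) (A : Finset V) : SimpleGraph V where
  Adj x y := x ∈ A ∧ y ∈ A ∧ x ≠ y ∧ ¬ G.Adj x y
  symm := ⟨fun _ _ h => ⟨h.2.1, h.1, h.2.2.1.symm, fun h' => h.2.2.2 h'.symm⟩⟩
  loopless := ⟨fun _ h => h.2.2.1 rfl⟩

lemma pairCount_nonadjOn : (G.nonadjOn A).pairCount A A = #A * (#A - 1) - G.pairCount A A := by
  have h : (G.nonadjOn A).pairCount A A + G.pairCount A A = ∑ a ∈ A, (#A - 1 : ℤ) := by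
    rw [pairCount, pairCount, ← sum_add_distrib]
    refine sum_congr rfl fun a ha => ?_
    rw [← sum_add_distrib]
    have h₁ : ∀ b ∈ A, ((if (G.nonadjOn A).Adj a b then 1 else 0) + if G.Adj a b then 1 else 0 : ℤ)
        = 1 - if b = a then 1 else 0 := by
      intro b hb
      by_cases hab : a = b
      · subst hab; simp
      · have : (G.nonadjOn A).Adj a b ↔ ¬ G.Adj a b := by simp [nonadjOn, ha, hb, hab]
        by_cases h : G.Adj a b <;> simp [this, h, Ne.symm hab]
    rw [sum_congr rfl h₁, sum_sub_distrib]
    simp [ha]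
  rw [sum_const, nsmul_eq_mul] at h
  linarith

lemma GrowsFrom.two_mul_card_le_pairCount {r : V} {D : Finset V} (hD : G.GrowsFrom r D) :
    2 * ((#D : ℤ) - 1) ≤ G.pairCount D D := by
  induction hD with
  | single => simpa using pairCount_nonneg
  | @grow D u w _ hu hadj ih =>
    by_cases hw : w ∈ D
    · rwa [insert_eq_of_mem hw]
    · have h₁ : Disjoint ({w} : Finset V) D := by simpa using hw
      have h₂ : 0 < #{b ∈ D | G.Adj w b} := card_pos.2 ⟨u, by simp [hu, hadj.symm]⟩
      rw [card_insert_of_notMem hw, insert_eq, pairCount_union_self h₁, pairCount_singleton_self,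
        pairCount_singleton_left]
      push_cast
      lia

end PairCount

section Fintype

variable {V : Type*} [Fintype V] {G : SimpleGraph V}

lemma pairCount_univ : G.pairCount univ univ = 2 * (G.edgeSet.ncard : ℤ) := by
  have h := G.sum_degrees_eq_twice_card_edges
  rw [← coe_edgeFinset, Set.ncard_coe_finset, pairCount_eq_sum_card]
  rw [← Nat.cast_two, ← Nat.cast_mul, ← h]
  push_cast
  refine sum_congr rfl fun a _ => ?_
  rw [← card_neighborFinset_eq_degree]
  congr 2
  ext; simp

variable [DecidableEq V]

/-- Every vertex lies in a connected set that is closed under adjacency. -/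
lemma exists_growsFrom_closed (G : SimpleGraph V) (r : V) :
    ∃ D, G.GrowsFrom r D ∧ ∀ x ∈ D, ∀ y, G.Adj x y → y ∈ D := by
  let F : Finset (Finset V) := {E | G.GrowsFrom r E}
  obtain ⟨D, hD, hmax⟩ := F.exists_max_image card ⟨{r}, by simpa [F] using GrowsFrom.single⟩
  simp only [F, mem_filter, mem_univ, true_and] at hD hmax
  refine ⟨D, hD, fun x hx y hxy => ?_⟩
  by_contra hy
  have := hmax _ (hD.grow hx hxy)
  rw [card_insert_of_notMem hy] at this
  lia

/-- A set of mutually reachable vertices forces at least as many edges as a tree spanning it. -/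
lemma two_mul_card_le_pairCount_of_reachable {S : Finset V}
    (h : ∀ x ∈ S, ∀ y ∈ S, G.Reachable x y) :
    2 * ((#S : ℤ) - 1) ≤ G.pairCount univ univ := by
  rcases S.eq_empty_or_nonempty with rfl | ⟨s, hs⟩
  · exact le_trans (by simp) pairCount_nonneg
  · obtain ⟨D, hD, hcl⟩ := G.exists_growsFrom_closed s
    have hSD : S ⊆ D := by
      intro y hy
      by_contra hyD
      obtain ⟨p⟩ := h s hs y hy
      obtain ⟨d, -, h₁, h₂⟩ := p.exists_boundary_dart (D : Set V) hD.root_mem (by simpa using hyD)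
      exact h₂ (hcl _ h₁ _ d.adj)
    have h₁ := hD.two_mul_card_le_pairCount
    have h₂ := pairCount_mono (G := G) (subset_univ D) (subset_univ D)
    have h₃ := card_le_card hSD
    lia

lemma pairCount_nonadjOn_univ {A : Finset V} :
    (G.nonadjOn A).pairCount univ univ = #A * (#A - 1) - G.pairCount A A := by
  rw [← pairCount_nonadjOn, ← union_compl A, pairCount_union_self disjoint_compl_right]
  rw [pairCount_eq_zero (A := A) (B := Aᶜ), pairCount_eq_zero (A := Aᶜ) (B := Aᶜ)]
  · ring
  · intro a ha b hb h; exact (mem_compl.1 ha) h.1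
  · intro a ha b hb h; exact (mem_compl.1 hb) h.2.1

variable (G)

/-- The vertices at distance at least two from `v`. -/
noncomputable def farSet (v : V) : Finset V := {x | x ≠ v ∧ ¬ G.Adj v x}

variable {G}

@[simp] lemma mem_farSet {v x : V} : x ∈ G.farSet v ↔ x ≠ v ∧ ¬ G.Adj v x := by simp [farSet]

lemma disjoint_neighborFinset_farSet {v : V} : Disjoint (G.neighborFinset v) (G.farSet v) := by
  rw [Finset.disjoint_left]; intro x; simp; grind

lemma univ_eq_neighborFinset_union_farSet (v : V) :
    (univ : Finset V) = {v} ∪ (G.neighborFinset v ∪ G.farSet v) := by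
  ext x; simp; grind

lemma card_eq_add_card_farSet (v : V) :
    Fintype.card V = 1 + #(G.neighborFinset v) + #(G.farSet v) := by
  rw [← card_univ, univ_eq_neighborFinset_union_farSet (G := G) v, card_union_of_disjoint,
    card_union_of_disjoint disjoint_neighborFinset_farSet]
  · simp; ring
  · simp

/-- The edge count split according to the distance classes of `v`. -/
lemma pairCount_univ_split (v : V) :
    G.pairCount univ univ = 2 * #(G.neighborFinset v)
      + G.pairCount (G.neighborFinset v) (G.neighborFinset v)
      + 2 * G.pairCount (G.neighborFinset v) (G.farSet v)
      + G.pairCount (G.farSet v) (G.farSet v) := by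
  have h₁ : Disjoint {v} (G.neighborFinset v ∪ G.farSet v) := by simp
  rw [univ_eq_neighborFinset_union_farSet (G := G) v, pairCount_union_self h₁,
    pairCount_union_self disjoint_neighborFinset_farSet, pairCount_singleton_self,
    pairCount_singleton_left]
  have : ({b ∈ G.neighborFinset v ∪ G.farSet v | G.Adj v b} : Finset V) = G.neighborFinset v := by
    ext x; simp; grind
  rw [this]
  ring

end Fintype

end

/-! ### Vertex elimination -/

section

section Eliminate

variable {V : Type*} (G : SimpleGraph V) (v : V)

/-- Elimination of the vertex `v`: delete `v` and make its neighbourhood a clique. -/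
def eliminate : SimpleGraph {x // x ≠ v} where
  Adj x y := x ≠ y ∧ (G.Adj x y ∨ G.Adj v x ∧ G.Adj v y)
  symm := ⟨fun _ _ h => ⟨h.1.symm, h.2.imp (fun h => h.symm) fun h => h.symm⟩⟩
  loopless := ⟨fun _ h => h.1 rfl⟩

variable {G v}

lemma eliminate_adj {x y : {x // x ≠ v}} :
    (G.eliminate v).Adj x y ↔ x ≠ y ∧ (G.Adj x y ∨ G.Adj v x ∧ G.Adj v y) := Iff.rfl

lemma Connected.eliminate (hG : G.Connected) [Nonempty {x // x ≠ v}] :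
    (G.eliminate v).Connected := by
  refine connected_of_exists_adj_crossing fun S x y hx hy => ?_
  by_cases hS : ∃ s ∈ S, G.Adj v s
  · obtain ⟨s, hs, hvs⟩ := hS
    obtain ⟨a, ha, b, hb, hab⟩ := hG.exists_adj_crossing
      (S := {z | ∀ h : z ≠ v, (⟨z, h⟩ : {x // x ≠ v}) ∈ S}) (x := x) (y := y)
      (fun _ => hx) (fun h => hy (h y.2))
    have hb' : ∃ h : b ≠ v, (⟨b, h⟩ : {x // x ≠ v}) ∉ S := by simpa using hb
    obtain ⟨hbv, hbS⟩ := hb'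
    by_cases hav : a = v
    · subst hav
      exact ⟨s, hs, ⟨b, hbv⟩, hbS, fun h => hbS (h ▸ hs), Or.inr ⟨hvs, hab⟩⟩
    · have haS := ha hav
      exact ⟨⟨a, hav⟩, haS, ⟨b, hbv⟩, hbS, fun h => hbS (h ▸ haS), Or.inl hab⟩
  · push Not at hS
    obtain ⟨a, ⟨hav, haS⟩, b, hb, hab⟩ := hG.exists_adj_crossing
      (S := {z | ∃ h : z ≠ v, (⟨z, h⟩ : {x // x ≠ v}) ∈ S}) (x := x) (y := y)
      ⟨x.2, hx⟩ (fun ⟨_, h⟩ => hy h)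
    have hbv : b ≠ v := by rintro rfl; exact hS _ haS hab.symm
    have hbS : (⟨b, hbv⟩ : {x // x ≠ v}) ∉ S := fun h => hb ⟨hbv, h⟩
    exact ⟨⟨a, hav⟩, haS, ⟨b, hbv⟩, hbS, fun h => hbS (h ▸ haS), Or.inl hab⟩

variable [DecidableEq V]

/-- A connected set of the eliminated graph is connected in `G`, after adding `v` if it meets the
neighbourhood of `v`. -/
lemma GrowsFrom.of_eliminate {r : {x // x ≠ v}} {D : Finset {x // x ≠ v}}
    (hD : (G.eliminate v).GrowsFrom r D) :
    ((∀ x ∈ D, ¬ G.Adj v x) ∧ G.GrowsFrom r.1 (D.image Subtype.val)) ∨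
      ((∃ x ∈ D, G.Adj v x) ∧ G.GrowsFrom r.1 (insert v (D.image Subtype.val))) := by
  induction hD with
  | single =>
    by_cases h : G.Adj v r
    · exact Or.inr ⟨⟨r, by simp, h⟩, by simpa using GrowsFrom.pair h.symm⟩
    · exact Or.inl ⟨by simpa using h, by simpa using GrowsFrom.single⟩
  | @grow D u w _ hu hadj ih =>
    rw [image_insert]
    have hu' : u.1 ∈ D.image Subtype.val := mem_image_of_mem _ hu
    rcases ih with ⟨h₁, h₂⟩ | ⟨h₁, h₂⟩
    · have huw : G.Adj u w := hadj.2.resolve_right fun h => h₁ u hu h.1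
      have h₃ := h₂.grow hu' huw
      by_cases h : G.Adj v w
      · exact Or.inr ⟨⟨w, mem_insert_self _ _, h⟩, h₃.grow (mem_insert_self _ _) h.symm⟩
      · refine Or.inl ⟨fun x hx => ?_, h₃⟩
        rcases mem_insert.1 hx with rfl | hx
        exacts [h, h₁ x hx]
    · obtain ⟨x, hx, hvx⟩ := h₁
      refine Or.inr ⟨⟨x, mem_insert_of_mem hx, hvx⟩, ?_⟩
      rw [insert_comm]
      rcases hadj.2 with h | h
      · exact h₂.grow (mem_insert_of_mem hu') h
      · exact h₂.grow (mem_insert_self _ _) h.2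

variable [Fintype V]

/-- Elimination does not enlarge the maximum boundary of a connected set. -/
lemma card_outerBoundary_eliminate_le {t : ℕ}
    (ht : ∀ r D, G.GrowsFrom r D → #(G.outerBoundary D) ≤ t) {r : {x // x ≠ v}}
    {D : Finset {x // x ≠ v}} (hD : (G.eliminate v).GrowsFrom r D) :
    #((G.eliminate v).outerBoundary D) ≤ t := by
  rw [← card_image_of_injective _ Subtype.val_injective]
  rcases hD.of_eliminate with ⟨h₁, h₂⟩ | ⟨⟨x, hx, hvx⟩, h₂⟩
  · refine (card_le_card fun y hy => ?_).trans (ht _ _ h₂)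
    obtain ⟨y, hy', rfl⟩ := mem_image.1 hy
    obtain ⟨hyD, u, hu, huy⟩ := mem_outerBoundary.1 hy'
    have : G.Adj u y := huy.2.resolve_right fun h => h₁ u hu h.1
    refine mem_outerBoundary.2 ⟨fun h => ?_, u, mem_image_of_mem _ hu, this⟩
    obtain ⟨z, hz, hzy⟩ := mem_image.1 h
    exact hyD (Subtype.ext hzy ▸ hz)
  · refine (card_le_card fun y hy => ?_).trans (ht _ _ h₂)
    obtain ⟨y, hy', rfl⟩ := mem_image.1 hy
    obtain ⟨hyD, u, hu, huy⟩ := mem_outerBoundary.1 hy'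
    refine mem_outerBoundary.2 ⟨fun h => ?_, ?_⟩
    · obtain ⟨z, hz, hzy⟩ := mem_image.1 ((mem_insert.1 h).resolve_left y.2)
      exact hyD (Subtype.ext hzy ▸ hz)
    · rcases huy.2 with h | h
      · exact ⟨u, mem_insert_of_mem (mem_image_of_mem _ hu), h⟩
      · exact ⟨v, mem_insert_self _ _, h.2⟩

/-- Elimination of `v` deletes its edges and creates one for each non-adjacent pair of its
neighbours. -/
lemma pairCount_eliminate :
    (G.eliminate v).pairCount univ univ = G.pairCount univ univ - 2 * #(G.neighborFinset v)
      + (#(G.neighborFinset v) * (#(G.neighborFinset v) - 1)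
        - G.pairCount (G.neighborFinset v) (G.neighborFinset v)) := by
  set N := G.neighborFinset v with hN
  set U : Finset V := univ.erase v with hU
  have hmem : ∀ x, x ∈ U ↔ x ≠ v := by simp [hU]
  have hsub : N ⊆ U := by
    intro x hx
    rw [hmem]
    rintro rfl
    simp [hN] at hx
  have h₁ : (G.eliminate v).pairCount univ univ
      = G.pairCount U U + (G.nonadjOn N).pairCount U U := by
    rw [pairCount, pairCount, pairCount, ← sum_add_distrib, sum_subtype U hmem]
    refine sum_congr rfl fun x _ => ?_
    rw [← sum_add_distrib, sum_subtype U hmem]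
    refine sum_congr rfl fun y _ => ?_
    by_cases hxy : G.Adj x y
    · have : ¬ (G.nonadjOn N).Adj x y := fun h => h.2.2.2 hxy
      have hne : x ≠ y := fun h => hxy.ne (by rw [h])
      simp [this, hxy, eliminate_adj, hne]
    · have : (G.nonadjOn N).Adj x y ↔ (G.eliminate v).Adj x y := by
        simp [nonadjOn, eliminate_adj, hxy, hN, Subtype.ext_iff]; tauto
      simp [hxy, this]
  have h₂ : (G.nonadjOn N).pairCount U U = (G.nonadjOn N).pairCount N N := by
    refine le_antisymm ?_ (pairCount_mono hsub hsub)
    rw [pairCount_nonadjOn, ← pairCount_nonadjOn_univ]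
    exact pairCount_mono (subset_univ _) (subset_univ _)
  have h₃ : G.pairCount univ univ = G.pairCount U U + 2 * #N := by
    have hd : Disjoint {v} U := by simp [hU]
    have hu : (univ : Finset V) = {v} ∪ U := by ext x; simp [hU]
    rw [hu, pairCount_union_self hd, pairCount_singleton_self, pairCount_singleton_left]
    have : ({b ∈ U | G.Adj v b} : Finset V) = N := by
      ext x; simp [hN, hmem]; intro h; exact h.ne'
    rw [this]; ring
  rw [h₁, h₂, h₃, pairCount_nonadjOn]
  ring

end Eliminate

end

/-! ### The edge bound: a vertex whose degree is the maximum boundary -/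

section

universe u

/-- The edge bound for graphs on `k` vertices: if all boundaries of connected sets have at most `t`
vertices, where `t + 3 ≤ k`, then a connected graph has fewer than `k + t.choose 2` edges.
Both sides are doubled. -/
def EdgeBound (k : ℕ) : Prop :=
  ∀ (V : Type u) [Fintype V] [DecidableEq V] (G : SimpleGraph V) (t : ℕ), Fintype.card V = k →
    t + 3 ≤ k → G.Connected → (∀ r D, G.GrowsFrom r D → #(G.outerBoundary D) ≤ t) →
      G.pairCount univ univ ≤ 2 * k + t * (t - 1) - 2

variable {V : Type u} [Fintype V] [DecidableEq V] {G : SimpleGraph V} {t : ℕ} {v : V}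

lemma card_neighborFinset_le (ht : ∀ r D, G.GrowsFrom r D → #(G.outerBoundary D) ≤ t) (v : V) :
    #(G.neighborFinset v) ≤ t := by
  refine (card_le_card fun x hx => ?_).trans (ht v _ .single)
  have hx := (G.mem_neighborFinset v x).1 hx
  exact mem_outerBoundary.2 ⟨by simpa using hx.ne', v, by simp, hx⟩

/-- A neighbour `w` of `v` has few neighbours far from `v`, since these lie in the boundary of
`{v, w}` together with the other neighbours of `v`. -/
lemma card_farSet_filter_le (ht : ∀ r D, G.GrowsFrom r D → #(G.outerBoundary D) ≤ t) {w : V}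
    (hw : G.Adj v w) : #{x ∈ G.farSet v | G.Adj w x} + #(G.neighborFinset v) ≤ t + 1 := by
  have h₁ := ht v _ (GrowsFrom.pair hw)
  have h₂ : {x ∈ G.farSet v | G.Adj w x} ∪ (G.neighborFinset v).erase w
      ⊆ G.outerBoundary {w, v} := by
    intro x hx
    simp only [mem_union, mem_filter, mem_farSet, mem_erase, mem_neighborFinset] at hx
    simp only [mem_outerBoundary, mem_insert, mem_singleton]
    have := G.irrefl (v := x)
    have : ¬ G.Adj v v := G.irrefl
    grind
  have h₃ := card_le_card h₂
  rw [card_union_of_disjoint, card_erase_of_mem (by simpa using hw)] at h₃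
  · lia
  · exact (disjoint_neighborFinset_farSet.mono_right (filter_subset _ _)).symm.mono_right
      (erase_subset _ _)

/-- If the neighbourhood of `v` misses at least `deg v - 1` edges, then elimination of `v` reduces the
edge bound to a smaller graph. So in a minimal counterexample every neighbourhood is nearly
complete. -/
lemma pairCount_le_of_sparse_neighborFinset (hIH : EdgeBound.{u} (Fintype.card V - 1))
    (hn : t + 4 ≤ Fintype.card V) (hG : G.Connected)
    (ht : ∀ r D, G.GrowsFrom r D → #(G.outerBoundary D) ≤ t) (v : V)
    (hv : G.pairCount (G.neighborFinset v) (G.neighborFinset v) + 2 * (#(G.neighborFinset v) - 1)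
      ≤ #(G.neighborFinset v) * (#(G.neighborFinset v) - 1)) :
    G.pairCount univ univ ≤ 2 * Fintype.card V + t * (t - 1) - 2 := by
  have hcard : Fintype.card {x // x ≠ v} = Fintype.card V - 1 := by
    simp
  have : Nonempty {x // x ≠ v} := Fintype.card_pos_iff.1 (by lia)
  have h := hIH {x // x ≠ v} (G.eliminate v) t (by rw [← hcard]) (by lia) hG.eliminate
    fun r D hD => card_outerBoundary_eliminate_le ht hD
  rw [pairCount_eliminate, Nat.cast_sub (by lia)] at h
  push_cast at h
  linarith

/-- If `v` has as many neighbours as any boundary can have, then two neighbours of `v` with distinct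
neighbours far from `v` are linked in the complement of the neighbourhood of `v`. -/
lemma reachable_nonadjOn (ht : ∀ r D, G.GrowsFrom r D → #(G.outerBoundary D) ≤ t)
    (hv : t ≤ #(G.neighborFinset v)) {w w' r r' : V} (hw : G.Adj v w) (hw' : G.Adj v w')
    (hr : r ∈ G.farSet v) (hr' : r' ∈ G.farSet v) (hrr' : r ≠ r') (hwr : G.Adj w r)
    (hwr' : G.Adj w' r') : (G.nonadjOn (G.neighborFinset v)).Reachable w w' := by
  by_contra hre
  rw [mem_farSet] at hr hr'
  have hww' : w ≠ w' := by rintro rfl; exact hre (Reachable.refl _)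
  have hadj : G.Adj w w' := by
    by_contra h
    exact hre (Adj.reachable ⟨by simpa using hw, by simpa using hw', hww', h⟩)
  have h₁ := ht w _ (GrowsFrom.pair hadj)
  have h₂ : insert v (insert r (insert r' (((G.neighborFinset v).erase w).erase w')))
      ⊆ G.outerBoundary {w', w} := by
    intro z hz
    have hvw := hw.ne
    have hvw' := hw'.ne
    have hz' : G.Adj v z → z ≠ w → z ≠ w' → G.Adj w z ∨ G.Adj w' z := by
      intro hvz hzw hzw'
      by_contra! h
      refine hre (Reachable.trans (v := z) (Adj.reachable ?_) (Adj.reachable ?_))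
      · exact ⟨by simpa using hw, by simpa using hvz, hzw.symm, h.1⟩
      · exact ⟨by simpa using hvz, by simpa using hw', hzw', fun h' => h.2 h'.symm⟩
    simp only [mem_insert, mem_erase, mem_neighborFinset] at hz
    simp only [mem_outerBoundary, mem_insert, mem_singleton]
    have := hw.symm
    grind
  have h₃ := card_le_card h₂
  have hN : w ∈ G.neighborFinset v := by simpa using hw
  have hN' : w' ∈ (G.neighborFinset v).erase w := by simpa using ⟨hww'.symm, hw'⟩
  have e₁ := card_erase_add_one hN
  have e₂ := card_erase_add_one hN'
  rw [card_insert_of_notMem, card_insert_of_notMem, card_insert_of_notMem] at h₃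
  · lia
  · simp [hr'.2]
  · simp [hr.2, hrr']
  · simp [hr.1.symm, hr'.1.symm]

/-- If `v` has as many neighbours as any boundary can have, and the far vertex `r` has a far
neighbour, then each common neighbour `w` of `v` and `r` has a non-neighbour among the other
neighbours of `v` that is not adjacent to `r` either. -/
lemma exists_nonadj_of_far_adj (ht : ∀ r D, G.GrowsFrom r D → #(G.outerBoundary D) ≤ t)
    (hv : t ≤ #(G.neighborFinset v)) {w r r' : V} (hw : G.Adj v w)
    (hr : r ∈ G.farSet v) (hr' : r' ∈ G.farSet v) (hwr : G.Adj w r)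
    (hrr' : G.Adj r r') : ∃ z, G.Adj v z ∧ z ≠ w ∧ ¬ G.Adj w z ∧ ¬ G.Adj r z := by
  by_contra! hz
  rw [mem_farSet] at hr hr'
  have h₁ := ht w _ (GrowsFrom.pair hwr)
  have h₂ : insert v (insert r' ((G.neighborFinset v).erase w)) ⊆ G.outerBoundary {r, w} := by
    intro z hzm
    have hvw := hw.ne
    have hne := hrr'.ne
    have hz := hz z
    simp only [mem_insert, mem_erase, mem_neighborFinset] at hzm
    simp only [mem_outerBoundary, mem_insert, mem_singleton]
    have := hw.symm
    grind
  have h₃ := card_le_card h₂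
  have hN : w ∈ G.neighborFinset v := by simpa using hw
  have e₁ := card_erase_add_one hN
  rw [card_insert_of_notMem, card_insert_of_notMem] at h₃
  · lia
  · simp [hr'.2]
  · simp [hr'.1.symm]

/-- The edge bound when some vertex `v` has degree `t`. Each neighbour of `v` has at most one far
neighbour, and the neighbours of `v` that have one force enough non-adjacent pairs among the
neighbours of `v`. -/
lemma pairCount_le_of_degree_eq (hIH : EdgeBound.{u} (Fintype.card V - 1))
    (hn : t + 3 ≤ Fintype.card V) (hG : G.Connected)
    (ht : ∀ r D, G.GrowsFrom r D → #(G.outerBoundary D) ≤ t)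
    (hv : #(G.neighborFinset v) = t) :
    G.pairCount univ univ ≤ 2 * Fintype.card V + t * (t - 1) - 2 := by
  by_contra hcon
  have hdense := fun hn r h => hcon (pairCount_le_of_sparse_neighborFinset hIH hn hG ht r h)
  have hcard := card_eq_add_card_farSet (G := G) v
  have hsplit := pairCount_univ_split (G := G) v
  have hH := pairCount_nonadjOn_univ (G := G) (A := G.neighborFinset v)
  have hHN := pairCount_nonadjOn (G := G) (A := G.neighborFinset v)
  have hnew : ∀ w ∈ G.neighborFinset v, #{x ∈ G.farSet v | G.Adj w x} ≤ 1 := fun w hw => by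
    have := card_farSet_filter_le ht (v := v) (w := w) (by simpa using hw)
    lia
  have hreach : ∀ {w w' r r' : V}, w ∈ G.neighborFinset v → w' ∈ G.neighborFinset v →
      r ∈ G.farSet v → r' ∈ G.farSet v → r ≠ r' → G.Adj w r → G.Adj w' r' →
      (G.nonadjOn (G.neighborFinset v)).Reachable w w' := fun hw hw' hr hr' h h₁ h₂ =>
    reachable_nonadjOn ht hv.ge (by simpa using hw) (by simpa using hw') hr hr' h h₁ h₂
  have hF : ∀ {w r r' : V}, w ∈ G.neighborFinset v → r ∈ G.farSet v → r' ∈ G.farSet v →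
      G.Adj w r → G.Adj r r' → ∃ z ∈ G.neighborFinset v, z ≠ w ∧ ¬ G.Adj w z ∧ ¬ G.Adj r z := by
    intro w r r' hw hr hr' h₁ h₂
    obtain ⟨z, hz, h⟩ := exists_nonadj_of_far_adj ht hv.ge (by simpa using hw) hr hr' h₁ h₂
    exact ⟨z, by simpa using hz, h⟩
  have hNQ : ∀ x ∈ G.neighborFinset v, x ∉ G.farSet v := fun x hx =>
    Finset.disjoint_left.1 disjoint_neighborFinset_farSet hx
  have htri : ∀ x, x = v ∨ x ∈ G.neighborFinset v ∨ x ∈ G.farSet v := by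
    intro x; simp; tauto
  have hvN : ∀ x, G.Adj v x → x ∈ G.neighborFinset v := fun x hx => by simpa using hx
  have hvQ : ∀ x ∈ G.farSet v, ¬ G.Adj v x := fun x hx => (mem_farSet.1 hx).2
  rw [hv] at hcard hsplit hH hHN
  have hQQ := pairCount_self_le (G := G) (A := G.farSet v)
  generalize hN : G.neighborFinset v = N at *
  generalize hQ : G.farSet v = Q at *
  have huniq : ∀ w ∈ N, ∀ x ∈ Q, ∀ y ∈ Q, G.Adj w x → G.Adj w y → x = y := fun w hw x hx y hy h h' =>
    card_le_one.1 (hnew w hw) x (by simp [hx, h]) y (by simp [hy, h'])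
  set W : Finset V := {w ∈ N | ∃ x ∈ Q, G.Adj w x} with hW
  have heNQ : G.pairCount N Q ≤ #W := by
    rw [pairCount_eq_sum_card, hW, card_filter]
    push_cast
    refine sum_le_sum fun w hw => ?_
    split_ifs with h
    · exact_mod_cast hnew w hw
    · have : ({b ∈ Q | G.Adj w b} : Finset V) = ∅ := by
        rw [filter_eq_empty_iff]; intro b hb hwb; exact h ⟨b, hb, hwb⟩
      simp [this]
  -- the bound follows once the far neighbours are paid for by non-adjacent pairs in `N`
  suffices hmain : 2 * #W + G.pairCount Q Q ≤ (G.nonadjOn N).pairCount univ univ + 2 * #Q by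
    rw [hH] at hmain
    refine hcon ?_
    rw [hsplit, hcard]
    push_cast
    linarith
  have hconn : ∀ r ∈ Q, ∀ r' ∈ Q, r ≠ r' → (∃ w ∈ N, G.Adj w r) → (∃ w ∈ N, G.Adj w r') →
      2 * ((#W : ℤ) - 1) ≤ (G.nonadjOn N).pairCount univ univ := by
    rintro r hr r' hr' hne ⟨w, hw, hwr⟩ ⟨w', hw', hwr'⟩
    refine two_mul_card_le_pairCount_of_reachable fun x hx y hy => ?_
    obtain ⟨hxN, rx, hrx, hx⟩ := mem_filter.1 hx
    obtain ⟨hyN, ry, hry, hy⟩ := mem_filter.1 hy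
    by_cases hxy : rx = ry
    · subst hxy
      by_cases hxr : rx = r
      · have h : rx ≠ r' := fun h => hne (hxr.symm.trans h)
        exact (hreach hxN hw' hrx hr' h hx hwr').trans (hreach hw' hyN hr' hrx h.symm hwr' hy)
      · exact (hreach hxN hw hrx hr hxr hx hwr).trans (hreach hw hyN hr hrx (Ne.symm hxr) hwr hy)
    · exact hreach hxN hyN hrx hry hxy hx hy
  by_cases hE : ∃ r ∈ Q, ∃ r' ∈ Q, G.Adj r r' ∧ ∃ w ∈ N, G.Adj w r
  · obtain ⟨r, hr, r', hr', hrr', w, hw, hwr⟩ := hE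
    by_cases hQ2 : #Q = 2
    · rw [hQ2] at hQQ ⊢
      by_cases hw' : ∃ w' ∈ N, G.Adj w' r'
      · have := hconn r hr r' hr' hrr'.ne ⟨w, hw, hwr⟩ hw'
        norm_num at hQQ ⊢
        linarith
      · -- every member of `W` is adjacent to `r`, so has a non-neighbour in `N \ W`
        have hQeq : Q = {r, r'} := by
          symm
          refine eq_of_subset_of_card_le (by simp [insert_subset_iff, hr, hr']) ?_
          rw [card_pair hrr'.ne, hQ2]
        have hWr : ∀ x ∈ W, G.Adj x r := by
          intro x hx
          obtain ⟨hxN, y, hy, hxy⟩ := mem_filter.1 hx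
          rw [hQeq, mem_insert, mem_singleton] at hy
          rcases hy with rfl | rfl
          · exact hxy
          · exact absurd ⟨x, hxN, hxy⟩ hw'
        have h₁ : (#W : ℤ) ≤ (G.nonadjOn N).pairCount W (N \ W) := by
          rw [pairCount_eq_sum_card, card_eq_sum_ones]
          push_cast
          refine sum_le_sum fun x hx => ?_
          obtain ⟨z, hz, hzx, hxz, hrz⟩ := hF (mem_filter.1 hx).1 hr hr' (hWr x hx) hrr'
          have : 0 < #{b ∈ N \ W | (G.nonadjOn N).Adj x b} := by
            refine card_pos.2 ⟨z, mem_filter.2 ⟨mem_sdiff.2 ⟨hz, fun h => ?_⟩, ?_⟩⟩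
            · exact hrz (hWr z h).symm
            · exact ⟨(mem_filter.1 hx).1, hz, hzx.symm, hxz⟩
          lia
        have h₂ : (G.nonadjOn N).pairCount N N
            = (G.nonadjOn N).pairCount W W + 2 * (G.nonadjOn N).pairCount W (N \ W)
              + (G.nonadjOn N).pairCount (N \ W) (N \ W) := by
          rw [← pairCount_union_self disjoint_sdiff, union_sdiff_of_subset (filter_subset _ _)]
        have h₃ : 0 ≤ (G.nonadjOn N).pairCount W W := pairCount_nonneg
        have h₄ : 0 ≤ (G.nonadjOn N).pairCount (N \ W) (N \ W) := pairCount_nonneg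
        norm_num at hQQ ⊢
        linarith
    · -- the neighbours of `r` in `N` and in `Q` are pairwise non-adjacent, so `r` can be eliminated
      refine (hdense (by lia) r ?_).elim
      have hd : Disjoint {x ∈ N | G.Adj r x} {x ∈ Q | G.Adj r x} := by
        rw [Finset.disjoint_left]
        intro x hx hx'
        exact hNQ x (mem_filter.1 hx).1 (mem_filter.1 hx').1
      have hNr : G.neighborFinset r = {x ∈ N | G.Adj r x} ∪ {x ∈ Q | G.Adj r x} := by
        ext x
        have h₁ : r = x → ¬ G.Adj r x := fun h h' => h'.ne h
        have h₂ := htri x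
        have h₃ : G.Adj r v → False := fun h => hvQ r hr h.symm
        simp only [mem_neighborFinset, mem_union, mem_filter]
        constructor
        · intro h
          rcases h₂ with rfl | h₂ | h₂
          exacts [(h₃ h).elim, Or.inl ⟨h₂, h⟩, Or.inr ⟨h₂, h⟩]
        · rintro (h | h) <;> exact h.2
      have h₀ : G.pairCount {x ∈ N | G.Adj r x} {x ∈ Q | G.Adj r x} = 0 := by
        refine pairCount_eq_zero fun a ha b hb hab => ?_
        rw [mem_filter] at ha hb
        exact hb.2.ne (huniq a ha.1 r hr b hb.1 ha.2.symm hab)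
      have h₁ : 0 < #{x ∈ N | G.Adj r x} := card_pos.2 ⟨w, by simp [hw, hwr.symm]⟩
      have h₂ : 0 < #{x ∈ Q | G.Adj r x} := card_pos.2 ⟨r', by simp [hr', hrr']⟩
      have h₃ := pairCount_self_le (G := G) (A := {x ∈ N | G.Adj r x})
      have h₄ := pairCount_self_le (G := G) (A := {x ∈ Q | G.Adj r x})
      rw [hNr, pairCount_union_self hd, card_union_of_disjoint hd, h₀]
      push_cast
      generalize #{x ∈ N | G.Adj r x} = a at *
      generalize #{x ∈ Q | G.Adj r x} = b at *
      have h₅ : 0 ≤ ((a : ℤ) - 1) * (b - 1) := mul_nonneg (by lia) (by lia)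
      linarith
  · push Not at hE
    have hY : ∀ r ∈ Q, ∃ w ∈ N, G.Adj w r := by
      intro r hr
      by_contra hrN
      have hvr : r ≠ v := by rintro rfl; rw [← hQ] at hr; simp at hr
      obtain ⟨a, ha, b, hb, hab⟩ := hG.exists_adj_crossing
        (S := {x | x = v ∨ x ∈ N ∨ x ∈ Q ∧ ∃ w ∈ N, G.Adj w x}) (x := v) (y := r) (by simp)
        (by simp only [Set.mem_ofPred_eq]; have := hNQ r; grind)
      simp only [Set.mem_ofPred_eq] at ha hb
      have hbQ : b ∈ Q := by have := htri b; tauto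
      rcases ha with rfl | ha | ⟨ha, w, hw, hwa⟩
      · exact hb (Or.inr (Or.inl (hvN b hab)))
      · exact hb (Or.inr (Or.inr ⟨hbQ, a, ha, hab⟩))
      · exact hE a ha b hbQ hab w hw hwa
    have h₀ : G.pairCount Q Q = 0 := pairCount_eq_zero fun a ha b hb hab => by
      obtain ⟨w, hw, hwa⟩ := hY a ha
      exact hE a ha b hb hab w hw hwa
    obtain ⟨r, hr, r', hr', hne⟩ := one_lt_card.1 (show 1 < #Q by lia)
    have := hconn r hr r' hr' hne (hY r hr) (hY r' hr')
    lia

end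

/-! ### The edge bound: all degrees below the maximum boundary -/

section

universe u

/-- A form of the edge bound without restriction on the order of the graph, in terms of the excess
`a` of the maximum boundary over `2`. -/
lemma exists_pairCount_le_of_connected {V : Type u} [Fintype V] [DecidableEq V]
    {G : SimpleGraph V} (hIH : EdgeBound.{u} (Fintype.card V)) (hG : G.Connected) :
    ∃ a : ℕ, G.pairCount univ univ ≤ 2 * Fintype.card V + a ^ 2 + 4 * a ∧
      (a = 0 ∨ ∀ k, ∃ E, G.GrowsFrom k E ∧ a + 1 ≤ #(G.outerBoundary E)) := by
  obtain ⟨v₀⟩ := hG.nonempty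
  let F : Finset (Finset V) := {D | ∃ r, G.GrowsFrom r D}
  obtain ⟨D, hD, hmax⟩ := F.exists_max_image (fun D => #(G.outerBoundary D))
    ⟨{v₀}, by simpa [F] using ⟨v₀, GrowsFrom.single⟩⟩
  simp only [F, mem_filter, mem_univ, true_and] at hD hmax
  obtain ⟨r, hD⟩ := hD
  refine ⟨#(G.outerBoundary D) - 2, ?_, ?_⟩
  · have ht : ∀ r E, G.GrowsFrom r E → #(G.outerBoundary E) ≤ #(G.outerBoundary D) - 2 + 2 :=
      fun r E hE => (hmax E ⟨r, hE⟩).trans (by lia)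
    generalize #(G.outerBoundary D) - 2 = a at ht
    by_cases hc : a + 5 ≤ Fintype.card V
    · have := hIH V G (a + 2) rfl (by lia) hG ht
      push_cast at this
      nlinarith
    · have hdeg := pairCount_le_mul (G := G) (A := univ) (B := univ) (c := a + 2) fun v _ => by
        have := card_neighborFinset_le ht v
        have h : ({b | G.Adj v b} : Finset V) = G.neighborFinset v := by ext; simp
        rw [h]; exact_mod_cast this
      have hself := pairCount_self_le (G := G) (A := univ)
      rw [card_univ] at hdeg hself
      have hpos : 1 ≤ Fintype.card V := Fintype.card_pos_iff.2 ⟨v₀⟩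
      generalize Fintype.card V = n at *
      by_cases hn : n = a + 4
      · subst hn
        push_cast at hdeg ⊢
        nlinarith
      · have h₁ : (n : ℤ) ≤ a + 3 := by lia
        have h₂ : (1 : ℤ) ≤ n := by lia
        have h₃ : (0 : ℤ) ≤ a := by lia
        nlinarith [mul_nonneg (sub_nonneg.2 h₁) (sub_nonneg.2 h₂)]
  · by_cases h : #(G.outerBoundary D) ≤ 2
    · left; lia
    · right
      intro k
      obtain ⟨E, hE, h'⟩ := hD.exists_root hG k
      exact ⟨E, hE, by lia⟩

variable {V : Type u} {G : SimpleGraph V}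

/-- The subgraph of `G` formed by the edges inside `A`. -/
def restrictTo (G : SimpleGraph V) (A : Finset V) : SimpleGraph V where
  Adj x y := x ∈ A ∧ y ∈ A ∧ G.Adj x y
  symm := ⟨fun _ _ h => ⟨h.2.1, h.1, h.2.2.symm⟩⟩
  loopless := ⟨fun _ h => h.2.2.ne rfl⟩

lemma pairCount_induce (K : Finset V) :
    (G.comap (Subtype.val : {x // x ∈ K} → V)).pairCount univ univ = G.pairCount K K := by
  simp only [pairCount, comap_adj]
  rw [← sum_coe_sort K]
  refine sum_congr rfl fun x _ => ?_
  rw [← sum_coe_sort K]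

variable [DecidableEq V]

lemma GrowsFrom.subset_of_restrictTo {A D : Finset V} {r : V} (hD : (G.restrictTo A).GrowsFrom r D)
    (hr : r ∈ A) : D ⊆ A := by
  induction hD with
  | single => simpa using hr
  | grow _ _ hadj ih => exact insert_subset hadj.2.1 ih

variable [Fintype V]

/-- The parts of the graph far from `v` are processed one component at a time: each component adds
to a connected set around `v` the excess of its own maximum boundary over `2`. -/
lemma exists_growsFrom_pairCount_farSet_le (hIH : ∀ k < Fintype.card V, EdgeBound.{u} k)
    (hG : G.Connected) (v : V) : ∃ (J : ℕ) (D : Finset V), G.GrowsFrom v D ∧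
      #(G.neighborFinset v) + J ≤ #(G.outerBoundary D) ∧
      G.pairCount (G.farSet v) (G.farSet v) ≤ 2 * #(G.farSet v) + J ^ 2 + 4 * J := by
  have hdisj : ∀ x ∈ G.neighborFinset v, x ∉ G.farSet v := fun x hx =>
    Finset.disjoint_left.1 disjoint_neighborFinset_farSet hx
  have htri : ∀ x, x = v ∨ x ∈ G.neighborFinset v ∨ x ∈ G.farSet v := by
    intro x; simp; tauto
  have hvQ : v ∉ G.farSet v := by simp
  have hvN : v ∉ G.neighborFinset v := by simp
  have hvadj : ∀ x ∈ G.neighborFinset v, G.Adj v x := fun x hx => by simpa using hx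
  have hbd : G.neighborFinset v ⊆ G.outerBoundary {v} := fun x hx =>
    mem_outerBoundary.2 ⟨by rintro h; exact hvN (mem_singleton.1 h ▸ hx), v, by simp, hvadj x hx⟩
  generalize hN : G.neighborFinset v = N at *
  have hvQadj : ∀ x ∈ G.farSet v, ¬ G.Adj v x := fun x hx => (mem_farSet.1 hx).2
  generalize hQ : G.farSet v = Q at *
  -- the claim for a union `U` of components of the subgraph induced by `Q`
  let P : Finset V → Prop := fun U => U ⊆ Q ∧ (∀ x ∈ U, ∀ y ∈ Q, G.Adj x y → y ∈ U) ∧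
    ∃ (J : ℕ) (D : Finset V), G.GrowsFrom v D ∧ D ⊆ {v} ∪ N ∪ U ∧
      #N + J ≤ #(G.outerBoundary D ∩ (N ∪ U)) ∧ G.pairCount U U ≤ 2 * #U + J ^ 2 + 4 * J
  let F : Finset (Finset V) := {U | P U}
  obtain ⟨U, hU, hmax⟩ := F.exists_max_image card ⟨∅, by
    simp only [F, P, mem_filter, mem_univ, true_and]
    refine ⟨by simp, by simp, 0, {v}, .single, by simp, ?_, ?_⟩
    · rw [union_empty, inter_eq_right.2 hbd, add_zero]
    · simp [pairCount]⟩
  simp only [F, mem_filter, mem_univ, true_and] at hU hmax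
  obtain ⟨hUQ, hUcl, J, D, hD, hDsub, hbdD, hcount⟩ := hU
  by_cases hUeq : U = Q
  · subst hUeq
    exact ⟨J, D, hD, hbdD.trans (card_le_card inter_subset_left), hcount⟩
  exfalso
  obtain ⟨x, hxQ, hxU⟩ := exists_of_ssubset (hUQ.ssubset_of_ne hUeq)
  obtain ⟨K, hK, hKcl'⟩ := (G.restrictTo Q).exists_growsFrom_closed x
  have hKQ : K ⊆ Q := hK.subset_of_restrictTo hxQ
  have hKcl : ∀ a ∈ K, ∀ y ∈ Q, G.Adj a y → y ∈ K := fun a ha y hy hay =>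
    hKcl' a ha y ⟨hKQ ha, hy, hay⟩
  have hKU : Disjoint U K := by
    rw [Finset.disjoint_left]
    intro y hyU hyK
    obtain ⟨a, ha, b, hb, haU, hbU, hab⟩ := hK.exists_adj_crossing (S := (U : Set V))
      ⟨y, hyK, hyU⟩ ⟨x, hK.root_mem, hxU⟩
    exact hbU (hUcl a haU b hab.2.1 hab.2.2)
  -- `K` is joined to the neighbourhood of `v`
  obtain ⟨k, hk, w, hwK, hkw⟩ := hG.exists_adj_crossing (S := (K : Set V)) (x := x) (y := v)
    hK.root_mem (fun h => hvQ (hKQ h))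
  have hwN : w ∈ N := by
    rcases htri w with rfl | h | h
    · exact absurd hkw.symm (hvQadj k (hKQ hk))
    · exact h
    · exact absurd (hKcl k hk w h hkw) hwK
  have hKconn : (G.comap (Subtype.val : {x // x ∈ K} → V)).Connected := by
    have : Nonempty {x // x ∈ K} := ⟨⟨k, hk⟩⟩
    refine connected_of_exists_adj_crossing fun S a b ha hb => ?_
    obtain ⟨a', ha', b', hb', ⟨h₁, h₂⟩, h₃, h₄⟩ := hK.exists_adj_crossing
      (S := {y | ∃ h : y ∈ K, (⟨y, h⟩ : {x // x ∈ K}) ∈ S}) ⟨a, a.2, a.2, ha⟩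
      ⟨b, b.2, fun ⟨_, h⟩ => hb h⟩
    exact ⟨⟨a', ha'⟩, h₂, ⟨b', hb'⟩, fun h => h₃ ⟨hb', h⟩, h₄.2.2⟩
  have hKcard : Fintype.card {x // x ∈ K} < Fintype.card V := by
    refine Fintype.card_subtype_lt (x := v) fun h => hvQ (hKQ h)
  obtain ⟨a, hcountK, ha⟩ := exists_pairCount_le_of_connected (hIH _ hKcard) hKconn
  rw [pairCount_induce, Fintype.card_coe] at hcountK
  have hUK : G.pairCount U K = 0 := pairCount_eq_zero fun y hy z hz hyz =>
    Finset.disjoint_left.1 hKU (hUcl y hy z (hKQ hz) hyz) hz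
  have hlt : #U < #(U ∪ K) := by
    rw [card_union_of_disjoint hKU]
    have := card_pos.2 ⟨k, hk⟩
    lia
  refine absurd (hmax (U ∪ K) ⟨union_subset hUQ hKQ, ?_, ?_⟩) (by lia)
  · intro y hy z hz hyz
    rcases mem_union.1 hy with hy | hy
    · exact mem_union_left _ (hUcl y hy z hz hyz)
    · exact mem_union_right _ (hKcl y hy z hz hyz)
  · rcases ha with rfl | ha
    · refine ⟨J, D, hD, hDsub.trans (union_subset_union_right subset_union_left),
        hbdD.trans (card_le_card ?_), ?_⟩
      · exact inter_subset_inter_left (union_subset_union_right subset_union_left)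
      · rw [pairCount_union_self hKU, card_union_of_disjoint hKU, hUK]
        push_cast at hcountK ⊢
        linarith
    · obtain ⟨E, hE, hEbd⟩ := ha ⟨k, hk⟩
      have hE' : G.GrowsFrom k (E.image Subtype.val) :=
        hE.map (⟨Subtype.val, fun h => h⟩ : (G.comap Subtype.val) →g G)
      have hEK : E.image Subtype.val ⊆ K := by
        intro y hy
        obtain ⟨z, -, rfl⟩ := mem_image.1 hy
        exact z.2
      have hDw : G.GrowsFrom v (insert w D) := hD.grow hD.root_mem (hvadj w hwN)
      refine ⟨J + a, insert w D ∪ E.image Subtype.val,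
        hDw.union hE' (mem_insert_self _ _) hkw.symm, ?_, ?_, ?_⟩
      · intro y hy
        have := @hDsub y
        have := @hEK y
        simp only [mem_union, mem_insert, mem_singleton] at *
        grind
      · have hsub : (G.outerBoundary D ∩ (N ∪ U)).erase w ∪
            ((G.comap (Subtype.val : {x // x ∈ K} → V)).outerBoundary E).image Subtype.val
            ⊆ G.outerBoundary (insert w D ∪ E.image Subtype.val) ∩ (N ∪ (U ∪ K)) := by
          intro y hy
          rcases mem_union.1 hy with hy | hy
          · simp only [mem_erase, mem_inter, mem_outerBoundary] at hy
            obtain ⟨hyw, ⟨hyD, u, hu, huy⟩, hyNU⟩ := hy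
            have hyK : y ∉ K := by
              intro h
              rcases mem_union.1 hyNU with h' | h'
              · exact hdisj y h' (hKQ h)
              · exact Finset.disjoint_left.1 hKU h' h
            refine mem_inter.2 ⟨mem_outerBoundary.2 ⟨?_, u, ?_, huy⟩, ?_⟩
            · simp only [mem_union, mem_insert, not_or]
              exact ⟨⟨hyw, hyD⟩, fun h => hyK (hEK h)⟩
            · exact mem_union_left _ (mem_insert_of_mem hu)
            · exact (union_subset_union_right subset_union_left) hyNU
          · obtain ⟨z, hz, rfl⟩ := mem_image.1 hy
            obtain ⟨hzE, u, hu, huz⟩ := mem_outerBoundary.1 hz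
            refine mem_inter.2 ⟨mem_outerBoundary.2 ⟨?_, u, ?_, huz⟩, ?_⟩
            · simp only [mem_union, mem_insert, not_or]
              refine ⟨⟨fun h => hwK (h ▸ z.2), fun h => ?_⟩, fun h => ?_⟩
              · have h := hDsub h
                simp only [mem_union, mem_singleton] at h
                rcases h with (h | h) | h
                · exact hvQ (hKQ (h ▸ z.2))
                · exact hdisj _ h (hKQ z.2)
                · exact Finset.disjoint_left.1 hKU h z.2
              · obtain ⟨z', hz', hzz'⟩ := mem_image.1 h
                exact hzE (Subtype.ext hzz' ▸ hz')
            · exact mem_union_right _ (mem_image_of_mem _ hu)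
            · exact mem_union_right _ (mem_union_right _ z.2)
        have hd : Disjoint ((G.outerBoundary D ∩ (N ∪ U)).erase w)
            (((G.comap (Subtype.val : {x // x ∈ K} → V)).outerBoundary E).image Subtype.val) := by
          rw [Finset.disjoint_left]
          intro y hy hy'
          obtain ⟨z, -, rfl⟩ := mem_image.1 hy'
          rcases mem_union.1 (mem_inter.1 (mem_erase.1 hy).2).2 with h | h
          · exact hdisj _ h (hKQ z.2)
          · exact Finset.disjoint_left.1 hKU h z.2
        have h₁ := card_le_card hsub
        rw [card_union_of_disjoint hd, card_image_of_injective _ Subtype.val_injective] at h₁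
        have h₂ := pred_card_le_card_erase (s := G.outerBoundary D ∩ (N ∪ U)) (a := w)
        lia
      · rw [pairCount_union_self hKU, card_union_of_disjoint hKU, hUK]
        push_cast at hcountK ⊢
        nlinarith [mul_nonneg (Nat.cast_nonneg (α := ℤ) J) (Nat.cast_nonneg (α := ℤ) a)]

end

section

universe u

section

variable {V : Type u} [Fintype V] [DecidableEq V] {G : SimpleGraph V} {t : ℕ} {v : V}

/-- The edge bound when all degrees are less than `t`. The non-adjacent pairs inside the
neighbourhood of a vertex `v` of maximum degree compensate the edges leaving it; the far part is
bounded component by component. -/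
lemma pairCount_le_of_degree_lt (hIH : ∀ k < Fintype.card V, EdgeBound.{u} k)
    (hn : t + 3 ≤ Fintype.card V) (hG : G.Connected)
    (ht : ∀ r D, G.GrowsFrom r D → #(G.outerBoundary D) ≤ t)
    (hmax : ∀ w, #(G.neighborFinset w) ≤ #(G.neighborFinset v))
    (h2 : 2 ≤ #(G.neighborFinset v)) (hv : #(G.neighborFinset v) < t) :
    G.pairCount univ univ ≤ 2 * Fintype.card V + t * (t - 1) - 2 := by
  have hcard := card_eq_add_card_farSet (G := G) v
  have hsplit := pairCount_univ_split (G := G) v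
  have hX : G.pairCount (G.neighborFinset v) (G.neighborFinset v)
      + G.pairCount (G.neighborFinset v) (G.farSet v)
      ≤ #(G.neighborFinset v) * (#(G.neighborFinset v) - 1) := by
    rw [← pairCount_union_right disjoint_neighborFinset_farSet]
    refine pairCount_le_mul fun w hw => ?_
    have hvw : v ∈ G.neighborFinset w := by
      rw [mem_neighborFinset] at hw ⊢; exact hw.symm
    have hsub : ({b ∈ G.neighborFinset v ∪ G.farSet v | G.Adj w b} : Finset V)
        ⊆ (G.neighborFinset w).erase v := by
      intro b hb
      obtain ⟨hb, hwb⟩ := mem_filter.1 hb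
      refine mem_erase.2 ⟨?_, by simpa using hwb⟩
      rintro rfl
      simp at hb
    have h₁ := card_le_card hsub
    have h₂ := card_erase_add_one hvw
    have h₃ := hmax w
    lia
  obtain ⟨j, hj⟩ := Nat.exists_eq_add_of_lt hv
  by_cases hn4 : t + 4 ≤ Fintype.card V
  · by_contra hcon
    have hdense := fun h => hcon
      (pairCount_le_of_sparse_neighborFinset (hIH _ (by lia)) hn4 hG ht v h)
    by_cases hd2 : #(G.neighborFinset v) = 2
    · have hdeg := pairCount_le_mul (G := G) (A := univ) (B := univ) (c := 2) fun w _ => by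
        have := hmax w
        have h : ({b | G.Adj w b} : Finset V) = G.neighborFinset w := by ext; simp
        rw [hd2] at this
        rw [h]; exact_mod_cast this
      rw [card_univ] at hdeg
      have : (2 : ℤ) ≤ t * (t - 1) := by
        have : (3 : ℤ) ≤ t := by lia
        nlinarith
      linarith
    · obtain ⟨J, D, hD, hJ, hQQ⟩ := exists_growsFrom_pairCount_farSet_le hIH hG v
      have hJ' := hJ.trans (ht v D hD)
      -- both counts are even, which sharpens the strict inequalities below
      have heven := pairCount_univ (G := G)
      have hevenN := pairCount_univ (G := G.nonadjOn (G.neighborFinset v))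
      rw [pairCount_nonadjOn_univ] at hevenN
      have hdense' : (#(G.neighborFinset v) * (#(G.neighborFinset v) - 1) : ℤ)
          - G.pairCount (G.neighborFinset v) (G.neighborFinset v)
          ≤ 2 * (#(G.neighborFinset v) - 2) := by
        have := not_le.1 hdense
        lia
      clear hdense hevenN
      generalize #(G.neighborFinset v) = d at *
      generalize #(G.farSet v) = q at *
      have hJj : (J : ℤ) ≤ j + 1 := by lia
      have hJ2 : (J : ℤ) ^ 2 + 4 * J ≤ (j + 1) ^ 2 + 4 * (j + 1) := by nlinarith
      subst hj
      rw [hcard] at hcon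
      rw [not_le] at hcon
      push_cast at *
      have hdd : (2 : ℤ) * (j * (d - 3)) ≥ 0 := by
        have : (3 : ℤ) ≤ d := by lia
        exact mul_nonneg (by norm_num) (mul_nonneg (by lia) (by lia))
      have hle : G.pairCount univ univ
          < 2 * (1 + d + q) + (d + j + 1) * (d + j + 1 - 1) - 2 + 2 := by
        rcases Nat.eq_zero_or_pos j with rfl | hj0
        · push_cast at *
          nlinarith
        · have : (1 : ℤ) ≤ j := by lia
          nlinarith
      obtain ⟨c, hc⟩ := Int.even_mul_pred_self ((d : ℤ) + j + 1)
      rw [heven] at hcon hle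
      rw [hc] at hcon hle
      lia
  · -- `#V = t + 3`: all summands can be bounded directly
    have hNQ : G.pairCount (G.neighborFinset v) (G.farSet v) ≤ #(G.neighborFinset v) * (j + 2) :=
      pairCount_le_mul fun w hw => by
        have := card_farSet_filter_le ht (v := v) (w := w) (by simpa using hw)
        lia
    have hQQ := pairCount_self_le (G := G) (A := G.farSet v)
    have hq : #(G.farSet v) = j + 3 := by lia
    rw [hq] at hQQ hcard
    generalize #(G.neighborFinset v) = d at *
    subst hj
    rw [hcard, hsplit]
    push_cast at *
    have : (0 : ℤ) ≤ (d - 2) * j := mul_nonneg (by lia) (by lia)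
    nlinarith

lemma Connected.exists_two_le_card_neighborFinset (hG : G.Connected) (h : 3 ≤ Fintype.card V) :
    ∃ v, 2 ≤ #(G.neighborFinset v) := by
  obtain ⟨x⟩ := hG.nonempty
  obtain ⟨y, hy⟩ := exists_mem_notMem_of_card_lt_card (s := {x}) (t := (univ : Finset V))
    (by rw [card_singleton, card_univ]; lia)
  obtain ⟨a, ha, b, hb, hab⟩ := hG.exists_adj_crossing (S := {x}) (x := x) (y := y) rfl
    (by simpa using hy)
  obtain rfl : a = x := ha
  obtain ⟨z, hz⟩ := exists_mem_notMem_of_card_lt_card (s := {a, b}) (t := (univ : Finset V))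
    (by rw [card_univ]; exact (card_le_two).trans_lt (by lia))
  obtain ⟨c, hc, d, hd, hcd⟩ := hG.exists_adj_crossing (S := {a, b}) (x := a) (y := z) (by simp)
    (by simpa using hz.2)
  simp only [Set.mem_insert_iff, Set.mem_singleton_iff, not_or] at hc hd
  rcases hc with rfl | rfl
  · exact ⟨c, one_lt_card.2 ⟨b, by simpa using hab, d, by simpa using hcd, Ne.symm hd.2⟩⟩
  · exact ⟨c, one_lt_card.2 ⟨a, by simpa using hab.symm, d, by simpa using hcd, Ne.symm hd.1⟩⟩

end

/-- The theorem of Ding, Johnson and Seymour on spanning trees with many leaves, in terms of boundaries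
of connected sets. -/
theorem edgeBound (k : ℕ) : EdgeBound.{u} k := by
  induction k using Nat.strong_induction_on with
  | _ k hIH =>
    intro V _ _ G t hk htk hG ht
    subst hk
    obtain ⟨v₀, hv₀⟩ := hG.exists_two_le_card_neighborFinset (by lia)
    obtain ⟨v, -, hv⟩ := (univ : Finset V).exists_max_image (fun v => #(G.neighborFinset v))
      ⟨v₀, mem_univ _⟩
    rcases (card_neighborFinset_le ht v).eq_or_lt with h | h
    · exact pairCount_le_of_degree_eq (hIH _ (by lia)) htk hG ht h
    · exact pairCount_le_of_degree_lt hIH htk hG ht (fun w => hv w (mem_univ _))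
        (hv₀.trans (hv v₀ (mem_univ _))) h

/-! ### The lower bounds for `mvc` in terms of the number of edges -/

section

variable {V : Type u} [Fintype V] {G : SimpleGraph V} {t : ℕ}

lemma Connected.le_mvc_of_le_pairCount (hG : G.Connected) (hn : t + 3 ≤ Fintype.card V)
    (hm : 2 * Fintype.card V + t * (t - 1) ≤ G.pairCount univ univ) : t + 2 ≤ G.mvc := by
  by_contra hlt
  have h := edgeBound _ V G t rfl hn hG fun r D hD => by
    have := hD.card_outerBoundary_lt_mvc hG
    lia
  lia

/-- The neighbours of two vertices at distance at least three are disjoint, which limits the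
number of edges. -/
lemma pairCount_le_of_far {x y : V} (hxy : x ≠ y) (hadj : ¬ G.Adj x y)
    (hcommon : ∀ w, G.Adj x w → ¬ G.Adj w y) :
    G.pairCount univ univ ≤ 2 * (#(G.neighborFinset x ∪ G.neighborFinset y) : ℤ)
      + G.pairCount (univ \ {x, y}) (univ \ {x, y}) ∧
    #(G.neighborFinset x ∪ G.neighborFinset y) = #(G.neighborFinset x) + #(G.neighborFinset y) ∧
    G.neighborFinset x ∪ G.neighborFinset y ⊆ univ \ {x, y} := by
  have hd : Disjoint (G.neighborFinset x) (G.neighborFinset y) := by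
    rw [Finset.disjoint_left]
    intro w hx hy
    rw [mem_neighborFinset] at hx hy
    exact hcommon w hx hy.symm
  refine ⟨?_, card_union_of_disjoint hd, ?_⟩
  · rw [card_union_of_disjoint hd]
    have hu : (univ : Finset V) = {x, y} ∪ (univ \ {x, y}) := by
      rw [union_sdiff_of_subset (subset_univ _)]
    conv_lhs => rw [hu, pairCount_union_self disjoint_sdiff]
    have h₀ : G.pairCount {x, y} {x, y} = 0 := pairCount_eq_zero fun a ha b hb h => by
      have := h.symm
      have := h.ne
      simp only [mem_insert, mem_singleton] at ha hb
      grind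
    have hp : ({x, y} : Finset V) = {x} ∪ {y} := insert_eq _ _
    have hle : ∀ z, G.pairCount {z} (univ \ {x, y}) ≤ #(G.neighborFinset z) := by
      intro z
      rw [pairCount_singleton_left]
      exact_mod_cast card_le_card fun b hb => by simpa using (mem_filter.1 hb).2
    have h₁ : G.pairCount {x, y} (univ \ {x, y})
        ≤ #(G.neighborFinset x) + #(G.neighborFinset y) := by
      conv_lhs => rw [hp]
      rw [pairCount_union_left (by simpa using hxy)]
      exact add_le_add (hle x) (hle y)
    push_cast
    linarith
  · intro w hw
    have := fun h : G.Adj y x => hadj h.symm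
    simp only [mem_union, mem_neighborFinset] at hw
    simp only [mem_sdiff, mem_univ, mem_insert, mem_singleton, true_and]
    rintro (rfl | rfl) <;> simp_all

lemma card_sdiff_pair {x y : V} (hxy : x ≠ y) :
    #((univ : Finset V) \ {x, y}) + 2 = Fintype.card V := by
  have h := card_sdiff_add_card_inter (univ : Finset V) {x, y}
  rwa [univ_inter, card_pair hxy, card_univ] at h

/-- More than `(n - 1).choose 2` edges force diameter at most two. -/
lemma card_le_mvc_of_lt_pairCount
    (hm : (Fintype.card V - 1 : ℤ) * (Fintype.card V - 2) < G.pairCount univ univ) :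
    Fintype.card V ≤ G.mvc := by
  refine card_le_mvc_of_forall_adj_or_common fun x y hxy => ?_
  by_contra! h
  obtain ⟨h₁, h₂, h₃⟩ := pairCount_le_of_far hxy h.1 h.2
  have h₄ := pairCount_self_le (G := G) (A := univ \ {x, y})
  have h₅ := card_le_card h₃
  have h₆ := card_sdiff_pair hxy
  have h₇ : (#((univ : Finset V) \ {x, y}) : ℤ) = Fintype.card V - 2 := by lia
  rw [h₇] at h₄
  have h₈ : (#(G.neighborFinset x ∪ G.neighborFinset y) : ℤ) ≤ Fintype.card V - 2 := by lia
  nlinarith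

/-- If there are two vertices `x`, `y` at distance at least three, then either some edge joining a
neighbour of `x` to a neighbour of `y` is dominating, or the neighbours of `x` and of `y` all lie in
one component of the complement; the latter leaves too few edges. -/
lemma Connected.card_sub_one_le_mvc (hG : G.Connected)
    (hm : (Fintype.card V - 2 : ℤ) * (Fintype.card V - 3) + 2 < G.pairCount univ univ) :
    Fintype.card V - 1 ≤ G.mvc := by
  by_cases hdiam : ∀ u v, u ≠ v → G.Adj u v ∨ ∃ w, G.Adj u w ∧ G.Adj w v
  · exact (Nat.sub_le _ _).trans (card_le_mvc_of_forall_adj_or_common hdiam)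
  push Not at hdiam
  obtain ⟨x, y, hxy, hadj, hcommon⟩ := hdiam
  obtain ⟨h₁, h₂, h₃⟩ := pairCount_le_of_far hxy hadj hcommon
  have h₆ := card_sdiff_pair hxy
  by_contra hlt
  have hnb : ∀ z z', z ≠ z' → ∃ a, G.Adj z a := by
    intro z z' h
    obtain ⟨a, rfl, b, -, hab⟩ := hG.exists_adj_crossing (S := {z}) (x := z) (y := z') rfl h.symm
    exact ⟨b, hab⟩
  obtain ⟨a₀, ha₀⟩ := hnb x y hxy
  obtain ⟨b₀, hb₀⟩ := hnb y x hxy.symm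
  have hA : ∀ {a}, G.Adj x a → a ∈ G.neighborFinset x ∪ G.neighborFinset y := fun h =>
    mem_union_left _ (by simpa using h)
  have hB : ∀ {b}, G.Adj y b → b ∈ G.neighborFinset x ∪ G.neighborFinset y := fun h =>
    mem_union_right _ (by simpa using h)
  have hreach : ∀ a b, G.Adj x a → G.Adj y b →
      (G.nonadjOn (univ \ {x, y})).Reachable a b := by
    intro a b ha hb
    by_contra hre
    have hab : a ≠ b := by rintro rfl; exact hre (Reachable.refl _)
    have hadj' : G.Adj a b := by
      by_contra h
      exact hre (Adj.reachable ⟨h₃ (hA ha), h₃ (hB hb), hab, h⟩)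
    have hdom : (univ : Finset V) \ {a, b} ⊆ G.outerBoundary {b, a} := by
      intro z hz
      simp only [mem_sdiff, mem_univ, mem_insert, mem_singleton, true_and, not_or] at hz
      simp only [mem_outerBoundary, mem_insert, mem_singleton]
      refine ⟨by tauto, ?_⟩
      by_contra! h
      have hzx : z ≠ x := by rintro rfl; exact h a (Or.inr rfl) ha.symm
      have hzy : z ≠ y := by rintro rfl; exact h b (Or.inl rfl) hb.symm
      have hzW : z ∈ (univ : Finset V) \ {x, y} := by simp [hzx, hzy]
      refine hre (Reachable.trans (v := z) (Adj.reachable ?_) (Adj.reachable ?_))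
      · exact ⟨h₃ (hA ha), hzW, Ne.symm hz.1, h a (Or.inr rfl)⟩
      · exact ⟨hzW, h₃ (hB hb), hz.2, fun h' => h b (Or.inl rfl) h'.symm⟩
    have e₁ := (GrowsFrom.pair hadj').card_outerBoundary_lt_mvc hG
    have e₂ := card_le_card hdom
    have e₃ := card_sdiff_pair hab
    lia
  have hcomp := two_mul_card_le_pairCount_of_reachable (G := G.nonadjOn (univ \ {x, y}))
    (S := G.neighborFinset x ∪ G.neighborFinset y) fun z hz z' hz' => by
      rw [mem_union, mem_neighborFinset, mem_neighborFinset] at hz hz'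
      rcases hz with hz | hz <;> rcases hz' with hz' | hz'
      · exact (hreach z b₀ hz hb₀).trans (hreach z' b₀ hz' hb₀).symm
      · exact hreach z z' hz hz'
      · exact (hreach z' z hz' hz).symm
      · exact (hreach a₀ z ha₀ hz).symm.trans (hreach a₀ z' ha₀ hz')
  rw [pairCount_nonadjOn_univ] at hcomp
  have h₇ : (#((univ : Finset V) \ {x, y}) : ℤ) = Fintype.card V - 2 := by lia
  rw [h₇] at hcomp
  nlinarith

end

end

/-! ### Upper bounds for `mvc`: subgraphs and representatives of the colours -/

section

section

variable {V : Type*} [Fintype V] {G H : SimpleGraph V}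

lemma mvc_mono (h : H ≤ G) : H.mvc ≤ G.mvc := by
  refine csSup_le' ?_
  rintro k ⟨f, hf, hmvc⟩
  refine le_mvc_of_surjective hf fun u v huv => ?_
  obtain ⟨p, hp, hmono⟩ := hmvc u v huv
  refine ⟨p.mapLe h, (Walk.isPath_mapLe h).2 hp, fun x hx y hy => ?_⟩
  rw [Walk.support_mapLe_eq_support] at hx hy
  exact hmono x hx y hy

/-- A connected graph has connected spanning subgraphs of every size from that of a tree on. -/
lemma Connected.exists_le_ncard_edgeSet_eq (hG : G.Connected) {m : ℕ}
    (h₁ : Fintype.card V ≤ m + 1) (h₂ : m ≤ G.edgeSet.ncard) :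
    ∃ H ≤ G, H.Connected ∧ H.edgeSet.ncard = m := by
  obtain ⟨T, hTG, hT⟩ := hG.exists_isTree_le
  have hTcard := hT.card_edgeFinset
  rw [← coe_edgeFinset, Set.ncard_coe_finset] at h₂
  obtain ⟨s, hTs, hsG, hs⟩ := exists_subsuperset_card_eq (edgeFinset_subset_edgeFinset.2 hTG)
    (show #T.edgeFinset ≤ m by lia) h₂
  have hedge : (fromEdgeSet (s : Set (Sym2 V))).edgeSet = s := by
    rw [edgeSet_fromEdgeSet, sdiff_eq_left, Set.disjoint_left]
    intro e he hd
    exact G.not_isDiag_of_mem_edgeSet (mem_edgeFinset.1 (hsG he)) hd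
  refine ⟨fromEdgeSet s, ?_, hT.connected.mono ?_, ?_⟩
  · rw [← edgeSet_subset_edgeSet, hedge]
    exact fun e he => mem_edgeFinset.1 (hsG he)
  · rw [← edgeSet_subset_edgeSet, hedge]
    exact fun e he => hTs (mem_edgeFinset.2 he)
  · rw [hedge, Set.ncard_coe_finset, hs]

end

/-- If every MVC-colouring is determined up to colours by a set of `c` vertices, then `mvc` is at
most `c`. -/
lemma mvc_le_of_exists_representatives {V : Type*} {G : SimpleGraph V} {c : ℕ}
    (h : ∀ (k : ℕ) (f : V → Fin k), G.IsMVCColoring f →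
      ∃ T : Finset V, #T ≤ c ∧ ∀ x, ∃ y ∈ T, f x = f y) : G.mvc ≤ c := by
  refine csSup_le' ?_
  rintro k ⟨f, hf, hmvc⟩
  obtain ⟨T, hT, hrep⟩ := h k f hmvc
  refine le_trans ?_ hT
  have : (univ : Finset (Fin k)) ⊆ T.image f := by
    intro i _
    obtain ⟨x, rfl⟩ := hf i
    obtain ⟨y, hy, hxy⟩ := hrep x
    exact mem_image.2 ⟨y, hy, hxy.symm⟩
  simpa using (card_le_card this).trans card_image_le

/-! ### Graphs with a long ear -/

section Ear

variable {V α : Type*} {G : SimpleGraph V} {C : Finset V} {q : ℕ → V} {K : ℕ} {f : V → α}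

/-- The graph `G` consists of a set `C` of vertices and an ear of length `K`: a path
`q 0, …, q K` outside `C` whose inner vertices have no further neighbours, and whose ends have no
further neighbours except in `C`. -/
structure HasEar (G : SimpleGraph V) (C : Finset V) (q : ℕ → V) (K : ℕ) : Prop where
  inj : ∀ i ≤ K, ∀ j ≤ K, q i = q j → i = j
  notMem : ∀ i ≤ K, q i ∉ C
  cover : ∀ x, x ∈ C ∨ ∃ i ≤ K, x = q i
  adj_inner : ∀ i y, 0 < i → i < K → G.Adj (q i) y → y = q (i - 1) ∨ y = q (i + 1)
  adj_left : ∀ y, G.Adj (q 0) y → y ∈ C ∨ y = q 1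
  adj_right : ∀ y, G.Adj (q K) y → y ∈ C ∨ y = q (K - 1)

lemma HasEar.reverse (h : G.HasEar C q K) : G.HasEar C (fun i => q (K - i)) K where
  inj i hi j hj hij := by have := h.inj _ (Nat.sub_le K i) _ (Nat.sub_le K j) hij; lia
  notMem i _ := h.notMem _ (Nat.sub_le K i)
  cover x := by
    rcases h.cover x with hx | ⟨i, hi, rfl⟩
    · exact Or.inl hx
    · exact Or.inr ⟨K - i, Nat.sub_le K i, by rw [Nat.sub_sub_self hi]⟩
  adj_inner i y h₀ h₁ hadj := by
    have := h.adj_inner (K - i) y (by lia) (by lia) hadj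
    rw [show K - (i - 1) = K - i + 1 by lia, show K - (i + 1) = K - i - 1 by lia]
    exact this.symm
  adj_left y hadj := h.adj_right y hadj
  adj_right y hadj := by
    rcases Nat.eq_zero_or_pos K with rfl | hK
    · exact h.adj_right y (by simpa using hadj)
    · rw [Nat.sub_self] at hadj
      rw [Nat.sub_sub_self hK]
      exact h.adj_left y hadj

lemma Walk.exists_adj_mem_support {u v : V} (p : G.Walk u v) (S : Set V) (hu : u ∈ S)
    (hv : v ∉ S) : ∃ a ∈ S, ∃ b ∉ S, G.Adj a b ∧ a ∈ p.support ∧ b ∈ p.support := by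
  obtain ⟨d, hd, h₁, h₂⟩ := p.exists_boundary_dart S hu hv
  exact ⟨d.fst, h₁, d.snd, h₂, d.adj, p.dart_fst_mem_support_of_mem_darts hd,
    p.dart_snd_mem_support_of_mem_darts hd⟩

/-- On a vertex-monochromatic path leaving a set `S`, the two ends of some edge leaving `S` have the
same colour, unless an end of that edge is an end of the path. -/
lemma IsMVCColoring.exists_crossing (hf : G.IsMVCColoring f) {u v : V} (S : Set V) (hu : u ∈ S)
    (hv : v ∉ S) : ∃ a ∈ S, ∃ b ∉ S, G.Adj a b ∧ (a = u ∨ b = v ∨ f a = f b) := by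
  obtain ⟨p, -, hp⟩ := hf u v (fun h => hv (h ▸ hu))
  obtain ⟨a, ha, b, hb, hab, hap, hbp⟩ := p.exists_adj_mem_support S hu hv
  refine ⟨a, ha, b, hb, hab, ?_⟩
  by_contra! h
  refine h.2.2 (hp _ hap _ hbp h.1 ?_ ?_ h.2.1)
  · rintro rfl; exact hv ha
  · rintro rfl; exact hb hu

/-- Two edges of the ear that are not monochromatic are close to each other: a vertex of the ear
between them must be linked to `C`. -/
lemma HasEar.eq_or_eq_of_add_three_le (h : G.HasEar C q K) (hf : G.IsMVCColoring f)
    (hC : C.Nonempty) {i j : ℕ} (hij : i + 3 ≤ j) (hj : j < K) :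
    f (q i) = f (q (i + 1)) ∨ f (q j) = f (q (j + 1)) := by
  obtain ⟨c, hc⟩ := hC
  have hcq : ∀ l ≤ K, c ≠ q l := fun l hl hcl => h.notMem l hl (hcl ▸ hc)
  obtain ⟨a, ⟨l, hl₁, hl₂, rfl⟩, b, hb, hab, hcol⟩ := hf.exists_crossing (u := q (i + 2)) (v := c)
    {x | ∃ l, i + 1 ≤ l ∧ l ≤ j ∧ x = q l} ⟨i + 2, by lia, by lia, rfl⟩
    (fun ⟨l, _, hl, hcl⟩ => hcq l (by lia) hcl)
  have hb' : ∀ l', i + 1 ≤ l' → l' ≤ j → b ≠ q l' := fun l' h₁ h₂ h₃ => hb ⟨l', h₁, h₂, h₃⟩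
  rcases h.adj_inner l b (by lia) (by lia) hab with rfl | rfl
  · obtain rfl : l = i + 1 := by
      by_contra hne; exact hb' (l - 1) (by lia) (by lia) rfl
    rcases hcol with h' | h' | h'
    · have := h.inj _ (by lia) _ (by lia) h'; lia
    · exact absurd h'.symm (hcq _ (by lia))
    · exact Or.inl h'.symm
  · obtain rfl : l = j := by
      by_contra hne; exact hb' (l + 1) (by lia) (by lia) rfl
    rcases hcol with h' | h' | h'
    · have := h.inj _ (by lia) _ (by lia) h'; lia
    · exact absurd h'.symm (hcq _ (by lia))
    · exact Or.inr h'

/-- If the colour of the end `q 0` does not occur in `C`, then `q 1` and `q (i + 2)` can only be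
linked along the ear. -/
lemma HasEar.eq_of_left (h : G.HasEar C q K) (hf : G.IsMVCColoring f)
    (h₀ : ∀ c ∈ C, f (q 0) ≠ f c) {i : ℕ} (hi : 2 ≤ i) (hiK : i + 2 ≤ K) :
    f (q i) = f (q (i + 1)) := by
  obtain ⟨a, ⟨l, hl, rfl⟩, b, hb, hab, hcol⟩ := hf.exists_crossing (u := q 1) (v := q (i + 2))
    {x | ∃ l, l ≤ i ∧ x = q l} ⟨1, by lia, rfl⟩
    (fun ⟨l, hl, hql⟩ => by have := h.inj _ (by lia) _ (by lia) hql; lia)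
  have hb' : ∀ l', l' ≤ i → b ≠ q l' := fun l' h₁ h₂ => hb ⟨l', h₁, h₂⟩
  rcases Nat.eq_zero_or_pos l with rfl | hl0
  · rcases h.adj_left b hab with hbC | rfl
    · rcases hcol with h' | rfl | h'
      · have := h.inj _ (by lia) _ (by lia) h'; lia
      · exact absurd hbC (h.notMem _ hiK)
      · exact absurd h' (h₀ b hbC)
    · exact absurd rfl (hb' 1 (by lia))
  · rcases h.adj_inner l b hl0 (by lia) hab with rfl | rfl
    · exact absurd rfl (hb' (l - 1) (by lia))
    · obtain rfl : l = i := by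
        by_contra hne; exact hb' (l + 1) (by lia) rfl
      rcases hcol with h' | h' | h'
      · have := h.inj _ (by lia) _ (by lia) h'; lia
      · have := h.inj _ (by lia) _ (by lia) h'; lia
      · exact h'

lemma HasEar.eq_of_right (h : G.HasEar C q K) (hf : G.IsMVCColoring f)
    (hK : ∀ c ∈ C, f (q K) ≠ f c) {i : ℕ} (hi : 1 ≤ i) (hiK : i + 3 ≤ K) :
    f (q i) = f (q (i + 1)) := by
  have := h.reverse.eq_of_left hf (by simpa using hK) (i := K - 1 - i) (by lia) (by lia)
  rw [show K - (K - 1 - i) = i + 1 by lia, show K - (K - 1 - i + 1) = i by lia] at this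
  exact this.symm

/-- A sequence without changes on an interval is constant there. -/
lemma eq_of_forall_eq_succ {g : ℕ → α} {a b : ℕ} (hab : a ≤ b)
    (h : ∀ l, a ≤ l → l < b → g l = g (l + 1)) : g a = g b := by
  induction b, hab using Nat.le_induction with
  | base => rfl
  | succ b hab ih => rw [ih fun l h₁ h₂ => h l h₁ (by lia), h b hab (by lia)]

lemma HasEar.exists_two_of_left_of_not_right (h : G.HasEar C q K) (hf : G.IsMVCColoring f)
    (hK4 : 4 ≤ K) (h₀ : ∃ c ∈ C, f (q 0) = f c) (hK : ∀ c ∈ C, f (q K) ≠ f c) :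
    ∃ a b, ∀ i ≤ K, (∃ c ∈ C, f (q i) = f c) ∨ f (q i) = f (q a) ∨ f (q i) = f (q b) := by
  have hC : C.Nonempty := ⟨_, h₀.choose_spec.1⟩
  have hin : ∀ l, 1 ≤ l → l < K - 2 → f (q l) = f (q (l + 1)) := fun l h₁ h₂ =>
    h.eq_of_right hf hK h₁ (by lia)
  by_cases h01 : f (q 0) = f (q 1)
  · refine ⟨K - 1, K, fun i hi => ?_⟩
    by_cases hi2 : i ≤ K - 2
    · left
      rwa [← eq_of_forall_eq_succ (g := fun l => f (q l)) (Nat.zero_le i)]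
      intro l _ hl
      rcases Nat.eq_zero_or_pos l with rfl | hl0
      exacts [h01, hin l hl0 (by lia)]
    · right
      obtain rfl | rfl : i = K - 1 ∨ i = K := by lia
      exacts [Or.inl rfl, Or.inr rfl]
  · have hlast := (h.eq_or_eq_of_add_three_le hf hC (i := 0) (j := K - 1) (by lia)
      (by lia)).resolve_left h01
    rw [show K - 1 + 1 = K by lia] at hlast
    refine ⟨1, K, fun i hi => ?_⟩
    by_cases hi0 : i = 0
    · subst hi0; exact Or.inl h₀
    by_cases hi2 : i ≤ K - 2
    · refine Or.inr (Or.inl ?_)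
      exact (eq_of_forall_eq_succ (g := fun l => f (q l)) (a := 1) (b := i) (by lia)
        fun l h₁ h₂ => hin l h₁ (by lia)).symm
    · obtain rfl | rfl : i = K - 1 ∨ i = K := by lia
      exacts [Or.inr (Or.inr hlast), Or.inr (Or.inr rfl)]

/-- An MVC-colouring uses at most two colours on a long ear that do not occur in `C`. -/
lemma HasEar.exists_two (h : G.HasEar C q K) (hf : G.IsMVCColoring f) (hC : C.Nonempty)
    (hK4 : 4 ≤ K) :
    ∃ a b, ∀ i ≤ K, (∃ c ∈ C, f (q i) = f c) ∨ f (q i) = f (q a) ∨ f (q i) = f (q b) := by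
  have hfar := fun i j => h.eq_or_eq_of_add_three_le hf hC (i := i) (j := j)
  by_cases h₀ : ∃ c ∈ C, f (q 0) = f c <;> by_cases hK : ∃ c ∈ C, f (q K) = f c
  · by_cases hall : ∀ l < K, f (q l) = f (q (l + 1))
    · refine ⟨0, 0, fun i hi => Or.inl ?_⟩
      rwa [← eq_of_forall_eq_succ (g := fun l => f (q l)) (Nat.zero_le i)
        fun l _ hl => hall l (by lia)]
    · -- after the first change of colour, at `s`, changes are only possible at `s + 1` and `s + 2`
      have hex : ∃ l, l < K ∧ f (q l) ≠ f (q (l + 1)) := by push Not at hall; exact hall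
      obtain ⟨hsK, hs⟩ := Nat.find_spec hex
      have hmin := fun l => Nat.find_min hex (m := l)
      generalize Nat.find hex = s at *
      refine ⟨s + 1, s + 2, fun i hi => ?_⟩
      by_cases his : i ≤ s
      · left
        rwa [← eq_of_forall_eq_succ (g := fun l => f (q l)) (Nat.zero_le i)]
        intro l _ hl
        by_contra hne
        exact hmin l (by lia) ⟨by lia, hne⟩
      by_cases his' : s + 3 ≤ i
      · left
        rwa [eq_of_forall_eq_succ (g := fun l => f (q l)) hi]
        exact fun l h₁ h₂ => (hfar s l (by lia) h₂).resolve_left hs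
      · obtain rfl | rfl : i = s + 1 ∨ i = s + 2 := by lia
        exacts [Or.inr (Or.inl rfl), Or.inr (Or.inr rfl)]
  · exact h.exists_two_of_left_of_not_right hf hK4 h₀ (by push Not at hK; exact hK)
  · push Not at h₀
    obtain ⟨a, b, hab⟩ := h.reverse.exists_two_of_left_of_not_right hf hK4 (by simpa using hK)
      (by simpa using h₀)
    refine ⟨K - a, K - b, fun i hi => ?_⟩
    have := hab (K - i) (Nat.sub_le _ _)
    rwa [Nat.sub_sub_self hi] at this
  · push Not at h₀ hK
    have hin : ∀ l, 1 ≤ l → l + 2 ≤ K → f (q l) = f (q (l + 1)) := fun l h₁ h₂ => by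
      by_cases hl : l = 1
      · exact h.eq_of_right hf hK h₁ (by lia)
      · exact h.eq_of_left hf h₀ (by lia) h₂
    refine ⟨0, K, fun i hi => ?_⟩
    have h01 := hfar 0 (K - 1) (by lia) (by lia)
    rw [show K - 1 + 1 = K by lia] at h01
    rcases h01 with h01 | h01
    · by_cases hiK : i = K
      · subst hiK; exact Or.inr (Or.inr rfl)
      · refine Or.inr (Or.inl (eq_of_forall_eq_succ (g := fun l => f (q l)) (Nat.zero_le i) ?_).symm)
        intro l _ hl
        rcases Nat.eq_zero_or_pos l with rfl | hl0
        exacts [h01, hin l hl0 (by lia)]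
    · by_cases hi0 : i = 0
      · subst hi0; exact Or.inr (Or.inl rfl)
      · refine Or.inr (Or.inr (eq_of_forall_eq_succ (g := fun l => f (q l)) hi ?_))
        intro l _ hl
        by_cases hlK : l = K - 1
        · subst hlK; simpa [show K - 1 + 1 = K by lia] using h01
        · exact hin l (by lia) (by lia)

lemma HasEar.mvc_le [Fintype V] (h : G.HasEar C q K) (hC : C.Nonempty) (hK4 : 4 ≤ K) :
    G.mvc ≤ #C + 2 := by
  refine mvc_le_of_exists_representatives fun k f hf => ?_
  obtain ⟨a, b, hab⟩ := h.exists_two hf hC hK4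
  refine ⟨C ∪ {q a, q b}, (card_union_le _ _).trans (by grind [card_le_two]), fun x => ?_⟩
  rcases h.cover x with hx | ⟨i, hi, rfl⟩
  · exact ⟨x, by simp [hx], rfl⟩
  · rcases hab i hi with ⟨c, hc, h'⟩ | h' | h'
    · exact ⟨c, by simp [hc], h'⟩
    · exact ⟨q a, by simp, h'⟩
    · exact ⟨q b, by simp, h'⟩

end Ear

end

/-! ### Extremal graphs -/

section

/-- The graph on `Fin n` whose edges `u < v` are prescribed by a relation on `ℕ`. -/
def ofLower (R : ℕ → ℕ → Prop) (n : ℕ) : SimpleGraph (Fin n) where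
  Adj u v := u < v ∧ R u v ∨ v < u ∧ R v u
  symm := ⟨fun _ _ h => h.symm⟩
  loopless := ⟨fun _ h => h.elim (fun h => lt_irrefl _ h.1) fun h => lt_irrefl _ h.1⟩

lemma ncard_edgeSet_ofLower (R : ℕ → ℕ → Prop) (n : ℕ) :
    (ofLower R n).edgeSet.ncard = ∑ a ∈ range n, #{b ∈ range n | b < a ∧ R b a} := by
  have h : ((ofLower R n).edgeSet.ncard : ℤ) =
      ∑ a : Fin n, ∑ b : Fin n, if b < a ∧ R b a then 1 else 0 := by
    have h₁ := pairCount_univ (G := ofLower R n)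
    have h₂ : (ofLower R n).pairCount univ univ =
        (∑ a : Fin n, ∑ b : Fin n, if b < a ∧ R b a then 1 else 0) +
          ∑ a : Fin n, ∑ b : Fin n, if a < b ∧ R a b then 1 else 0 := by
      rw [pairCount, ← sum_add_distrib]
      refine sum_congr rfl fun a _ => ?_
      rw [← sum_add_distrib]
      refine sum_congr rfl fun b _ => ?_
      rcases lt_trichotomy a b with hab | rfl | hab
      · simp [ofLower, hab, not_lt_of_gt hab]
      · simp
      · simp [ofLower, hab, not_lt_of_gt hab]
    rw [sum_comm (f := fun a b : Fin n => if a < b ∧ R a b then (1 : ℤ) else 0)] at h₂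
    linarith
  apply Nat.cast_injective (R := ℤ)
  rw [h, Nat.cast_sum, ← Fin.sum_univ_eq_sum_range (fun a => (#{b ∈ range n | b < a ∧ R b a} : ℤ)) n]
  refine sum_congr rfl fun a _ => ?_
  rw [← sum_boole, ← Fin.sum_univ_eq_sum_range (fun b => if b < ↑a ∧ R b ↑a then (1 : ℤ) else 0) n]
  rfl

/-- The edges of a clique on `0, …, t`, of all edges from `t + 1` to `1, …, t`, and of a path
`t + 1, t + 2, …`. -/
def TailRel (t u v : ℕ) : Prop := v ≤ t ∨ v = t + 1 ∧ 1 ≤ u ∨ t + 2 ≤ v ∧ u + 1 = v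

/-- A clique on `t + 1` vertices, all but one of which are joined to the first vertex of a path on
the remaining vertices. -/
def tailGraph (n t : ℕ) : SimpleGraph (Fin n) := ofLower (TailRel t) n

/-- The graph `tailGraph n t` with an additional edge joining the vertex `0` of the clique to the
last vertex of the path; equivalently, a clique on `t + 2` vertices with one edge subdivided. -/
def earGraph (n t : ℕ) : SimpleGraph (Fin n) :=
  ofLower (fun u v => TailRel t u v ∨ u = 0 ∧ v = n - 1) n

/-- A lower bound for the number of neighbours of `a` below `a`. -/
lemma tailRel_count {t a n : ℕ} (ha : a < n) :
    (if a ≤ t then a else if a = t + 1 then t else 1) ≤ #{b ∈ range n | b < a ∧ TailRel t b a} := by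
  split_ifs with h₁ h₂
  · calc a = #(range a) := (card_range a).symm
      _ ≤ _ := card_le_card fun b hb => by
        rw [mem_range] at hb
        simp only [mem_range, mem_filter]
        unfold TailRel; lia
  · calc t = #(Ico 1 (t + 1)) := by simp
      _ ≤ _ := card_le_card fun b hb => by
        rw [mem_Ico] at hb
        simp only [mem_range, mem_filter]
        unfold TailRel; lia
  · refine card_pos.2 ⟨a - 1, ?_⟩
    simp only [mem_range, mem_filter]
    unfold TailRel; lia

lemma sum_tail_count (t k : ℕ) :
    ∑ a ∈ range (t + 2 + k), (if a ≤ t then a else if a = t + 1 then t else 1)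
      = (t + 1).choose 2 + t + k := by
  rw [sum_range_add, sum_range_succ, Nat.choose_two_right, ← sum_range_id]
  congr 1
  · congr 1
    · refine sum_congr rfl fun a ha => ?_
      rw [if_pos (by rw [mem_range] at ha; lia)]
    · simp
  · refine (sum_congr rfl fun a _ => ?_).trans (by simp : ∑ _a ∈ range k, 1 = k)
    rw [if_neg (by lia), if_neg (by lia)]

lemma le_ncard_edgeSet_tailGraph {n t : ℕ} (hn : t + 2 ≤ n) :
    n + (t + 1).choose 2 ≤ (tailGraph n t).edgeSet.ncard + 2 := by
  obtain ⟨k, rfl⟩ := Nat.exists_eq_add_of_le hn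
  have h := sum_le_sum fun a (ha : a ∈ range (t + 2 + k)) => tailRel_count (t := t) (mem_range.1 ha)
  rw [sum_tail_count] at h
  rw [tailGraph, ncard_edgeSet_ofLower]
  lia

lemma le_ncard_edgeSet_earGraph {n t : ℕ} (ht : 1 ≤ t) (hn : t + 3 ≤ n) :
    n + (t + 1).choose 2 ≤ (earGraph n t).edgeSet.ncard + 1 := by
  have hlt : (tailGraph n t).edgeSet.ncard < (earGraph n t).edgeSet.ncard := by
    refine Set.ncard_lt_ncard ?_ (Set.toFinite _)
    rw [edgeSet_ssubset_edgeSet]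
    refine lt_of_le_of_ne ?_ fun h => ?_
    · rintro u v (⟨h₁, h₂⟩ | ⟨h₁, h₂⟩)
      exacts [Or.inl ⟨h₁, Or.inl h₂⟩, Or.inr ⟨h₁, Or.inl h₂⟩]
    · have h₁ : (earGraph n t).Adj ⟨0, by lia⟩ ⟨n - 1, by lia⟩ :=
        Or.inl ⟨by rw [Fin.lt_def]; dsimp only; lia, Or.inr ⟨rfl, rfl⟩⟩
      rw [← h] at h₁
      simp only [tailGraph, ofLower, TailRel, Fin.lt_def] at h₁
      lia
  have := le_ncard_edgeSet_tailGraph (n := n) (t := t) (by lia)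
  lia

/-- In `tailGraph n t` every path from `0` to the last vertex runs through a vertex of the clique and
then along the whole path. -/
lemma mvc_tailGraph_le {n t : ℕ} (ht : 1 ≤ t) (hn : t + 2 ≤ n) : (tailGraph n t).mvc ≤ t + 2 := by
  refine mvc_le_of_exists_representatives fun k f hf => ?_
  let u : Fin n := ⟨0, by lia⟩
  let v : Fin n := ⟨n - 1, by lia⟩
  have huv : u ≠ v := by simp only [u, v, ne_eq, Fin.mk.injEq]; lia
  obtain ⟨p, -, hp⟩ := hf u v huv
  obtain ⟨a, ha, c, hc, hac, -, hcp⟩ := p.exists_adj_mem_support {x | x.1 = 0} rfl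
    (by simp only [v, Set.mem_ofPred_eq]; lia)
  have hct : 1 ≤ c.1 ∧ c.1 ≤ t := by
    simp only [tailGraph, ofLower, TailRel, Fin.lt_def, Set.mem_ofPred_eq] at hac ha hc
    lia
  have hsupp : ∀ x : Fin n, t + 1 ≤ x.1 → x ∈ p.support := by
    intro x hx
    obtain ⟨a, ha, b, hb, hab, -, hbp⟩ := p.exists_adj_mem_support {y | y.1 < x.1}
      (by simp only [u, Set.mem_ofPred_eq]; lia)
      (by have := x.2; simp only [v, Set.mem_ofPred_eq]; lia)
    simp only [tailGraph, ofLower, TailRel, Fin.lt_def, Set.mem_ofPred_eq] at hab ha hb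
    have hxb : b = x := by rw [Fin.ext_iff]; lia
    exact hxb ▸ hbp
  refine ⟨insert v ({x | x.1 ≤ t} : Finset (Fin n)), ?_, fun x => ?_⟩
  · have : #({x | x.1 ≤ t} : Finset (Fin n)) ≤ #(range (t + 1)) :=
      card_le_card_of_injOn Fin.val (fun x hx => by simp at hx ⊢; lia)
        (Fin.val_injective.injOn)
    rw [card_range] at this
    have := card_insert_le v ({x | x.1 ≤ t} : Finset (Fin n))
    lia
  · by_cases hx : x.1 ≤ t
    · exact ⟨x, by simp [hx], rfl⟩
    by_cases hxv : x = v
    · exact ⟨x, by simp [hxv], rfl⟩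
    · refine ⟨c, by simp [hct.2], hp x (hsupp x (by lia)) c hcp ?_ hxv ?_ ?_⟩
      · simp only [u, ne_eq, Fin.ext_iff]; lia
      · simp only [u, ne_eq, Fin.ext_iff]; lia
      · simp only [v, ne_eq, Fin.ext_iff]; lia

lemma hasEar_earGraph {n t : ℕ} (hn : t + 5 ≤ n) :
    (earGraph n t).HasEar {x | 1 ≤ x.1 ∧ x.1 ≤ t}
      (fun i => if h : t + 1 + i < n then ⟨t + 1 + i, h⟩ else ⟨0, by lia⟩) (n - 1 - t) where
  inj i hi j hj hij := by
    split_ifs at hij <;> simp only [Fin.mk.injEq] at hij <;> lia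
  notMem i hi := by
    split_ifs
    · simp; lia
    · simp
  cover x := by
    by_cases hx : 1 ≤ x.1 ∧ x.1 ≤ t
    · left; simpa using hx
    right
    by_cases hx0 : x.1 = 0
    · refine ⟨n - 1 - t, le_rfl, ?_⟩
      rw [dif_neg (by lia)]; exact Fin.ext hx0
    · have := x.2
      refine ⟨x.1 - (t + 1), by lia, ?_⟩
      rw [dif_pos (by lia)]
      exact Fin.ext (by dsimp only; lia)
  adj_inner i y h₀ h₁ hadj := by
    have := y.2
    rw [dif_pos (by lia)] at hadj
    rw [dif_pos (by lia)]
    split_ifs <;> simp only [earGraph, ofLower, TailRel, Fin.lt_def, Fin.ext_iff] at hadj ⊢ <;> lia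
  adj_left y hadj := by
    have := y.2
    rw [dif_pos (by lia)] at hadj
    rw [dif_pos (by lia)]
    simp only [earGraph, ofLower, TailRel, Fin.lt_def, Fin.ext_iff, mem_filter, mem_univ,
      true_and] at hadj ⊢
    lia
  adj_right y hadj := by
    have := y.2
    rw [dif_neg (by lia)] at hadj
    rw [dif_pos (by lia)]
    simp only [earGraph, ofLower, TailRel, Fin.lt_def, Fin.ext_iff, mem_filter, mem_univ,
      true_and] at hadj ⊢
    lia

lemma mvc_earGraph_le {n t : ℕ} (ht : 1 ≤ t) (hn : t + 5 ≤ n) : (earGraph n t).mvc ≤ t + 2 := by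
  refine ((hasEar_earGraph hn).mvc_le ⟨⟨1, by lia⟩, by simp [ht]⟩ (by lia)).trans ?_
  have : #({x | 1 ≤ x.1 ∧ x.1 ≤ t} : Finset (Fin n)) ≤ #(Icc 1 t) :=
    card_le_card_of_injOn Fin.val (fun x hx => by simpa using hx) (Fin.val_injective.injOn)
  rw [Nat.card_Icc] at this
  lia

lemma connected_ofLower {R : ℕ → ℕ → Prop} {n : ℕ} (hn : 0 < n)
    (h : ∀ i, i + 1 < n → R i (i + 1)) : (ofLower R n).Connected := by
  have : Nonempty (Fin n) := ⟨⟨0, hn⟩⟩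
  have hreach : ∀ i (hi : i < n), (ofLower R n).Reachable ⟨0, hn⟩ ⟨i, hi⟩ := by
    intro i
    induction i with
    | zero => exact fun _ => Reachable.refl _
    | succ i ih =>
      intro hi
      refine (ih (by lia)).trans (Adj.reachable (Or.inl ⟨?_, h i hi⟩))
      rw [Fin.lt_def]; dsimp only; lia
  rw [connected_iff]
  exact ⟨fun x y => (hreach x x.2).symm.trans (hreach y y.2), this⟩

lemma connected_tailGraph {n t : ℕ} (ht : 1 ≤ t) (hn : 0 < n) : (tailGraph n t).Connected :=
  connected_ofLower hn fun i _ => by simp only [TailRel]; lia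

lemma connected_earGraph {n t : ℕ} (ht : 1 ≤ t) (hn : 0 < n) : (earGraph n t).Connected :=
  connected_ofLower hn fun i _ => by simp only [TailRel]; lia

/-- An upper bound for `mvc` attained by a graph with many edges is attained with `m` edges as soon as
it is a lower bound for all connected graphs with `m` edges. -/
lemma Connected.exists_mvc_eq {n m c : ℕ} {G : SimpleGraph (Fin n)} (hG : G.Connected)
    (hmvc : G.mvc ≤ c) (h₁ : n ≤ m) (h₂ : m ≤ G.edgeSet.ncard)
    (hc : ∀ H : SimpleGraph (Fin n), H.Connected → H.edgeSet.ncard = m → c ≤ H.mvc) :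
    ∃ H : SimpleGraph (Fin n), H.Connected ∧ H.edgeSet.ncard = m ∧ H.mvc = c := by
  obtain ⟨H, hHG, hH, hm⟩ := hG.exists_le_ncard_edgeSet_eq (m := m)
    (by rw [Fintype.card_fin]; lia) h₂
  exact ⟨H, hH, hm, ((mvc_mono hHG).trans hmvc).antisymm (hc H hH hm)⟩

lemma exists_mvc_eq_card {n m : ℕ} (hn : 0 < n) (h₁ : n ≤ m) (h₂ : m ≤ n.choose 2)
    (hc : ∀ H : SimpleGraph (Fin n), H.Connected → H.edgeSet.ncard = m → n ≤ H.mvc) :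
    ∃ H : SimpleGraph (Fin n), H.Connected ∧ H.edgeSet.ncard = m ∧ H.mvc = n := by
  have : Nonempty (Fin n) := ⟨⟨0, hn⟩⟩
  have hle := mvc_le_card (G := (⊤ : SimpleGraph (Fin n)))
  rw [Fintype.card_fin] at hle
  refine Connected.exists_mvc_eq connected_top hle h₁ ?_ hc
  rw [← coe_edgeFinset, Set.ncard_coe_finset, card_edgeFinset_top_eq_card_choose_two,
    Fintype.card_fin]
  exact h₂

lemma two_mul_choose_two (t : ℕ) : (2 * t.choose 2 : ℤ) = t * (t - 1) := by
  induction t with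
  | zero => simp
  | succ t ih =>
    rw [Nat.choose_succ_succ' t 1, Nat.choose_one_right]
    push_cast
    linarith

section

variable {V : Type*} [Fintype V] {G : SimpleGraph V} {n m t : ℕ}

lemma Connected.add_two_le_mvc (hG : G.Connected) (hV : Fintype.card V = n)
    (hm : G.edgeSet.ncard = m) (hn : t + 2 ≤ n) (hm1 : n + t.choose 2 ≤ m) : t + 2 ≤ G.mvc := by
  have htwo := two_mul_choose_two t
  have hcount := pairCount_univ (G := G)
  have hmz : (n : ℤ) + t.choose 2 ≤ m := by exact_mod_cast hm1
  rw [hm] at hcount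
  rcases hn.eq_or_lt with rfl | hn3
  · refine hV ▸ card_le_mvc_of_lt_pairCount ?_
    rw [hcount, hV]
    push_cast at hmz ⊢
    nlinarith
  · refine hG.le_mvc_of_le_pairCount (by lia) ?_
    rw [hcount, hV]
    lia

lemma Connected.add_three_le_mvc (hG : G.Connected) (hV : Fintype.card V = n)
    (hm : G.edgeSet.ncard = m) (hn : n = t + 3 ∨ n = t + 4)
    (hm1 : n + (t + 1).choose 2 ≤ m + 1) : t + 3 ≤ G.mvc := by
  have htwo := two_mul_choose_two (t + 1)
  have hcount := pairCount_univ (G := G)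
  have hmz : (n : ℤ) + (t + 1).choose 2 ≤ m + 1 := by exact_mod_cast hm1
  rw [hm] at hcount
  rcases hn with rfl | rfl
  · refine hV ▸ card_le_mvc_of_lt_pairCount ?_
    rw [hcount, hV]
    push_cast at *
    nlinarith
  · refine (show t + 3 = Fintype.card V - 1 by lia) ▸ hG.card_sub_one_le_mvc ?_
    rw [hcount, hV]
    push_cast at *
    nlinarith

end

end

end SimpleGraph


theorem theorem3p6 (n m t : ℕ) (hn : 3 ≤ n) (ht1 : 1 ≤ t) (ht2 : t ≤ n - 2)
    (hm1 : n + t.choose 2 ≤ m) (hm2 : m ≤ n + (t + 1).choose 2 - 1) :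
    -- the bound `t + 2`
    (∀ (V : Type*) [Fintype V] (G : SimpleGraph V), Fintype.card V = n → G.Connected →
      G.edgeSet.ncard = m → t + 2 ≤ G.mvc) ∧
    -- outside the exceptional cases it is attained
    (¬ (m = n + (t + 1).choose 2 - 1 ∧ (n = t + 3 ∨ n = t + 4)) →
      ∃ G : SimpleGraph (Fin n), G.Connected ∧ G.edgeSet.ncard = m ∧ G.mvc = t + 2) ∧
    -- in the exceptional cases the bound is `t + 3`, and it is attained
    ((m = n + (t + 1).choose 2 - 1 ∧ (n = t + 3 ∨ n = t + 4)) →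
      (∀ (V : Type*) [Fintype V] (G : SimpleGraph V), Fintype.card V = n → G.Connected →
        G.edgeSet.ncard = m → t + 3 ≤ G.mvc) ∧
      ∃ G : SimpleGraph (Fin n), G.Connected ∧ G.edgeSet.ncard = m ∧ G.mvc = t + 3) := by
  have hchoose : (t + 1).choose 2 = t.choose 2 + t := by
    rw [Nat.choose_succ_succ' t 1, Nat.choose_one_right, add_comm]
  have hchoose₂ : (t + 2).choose 2 = t.choose 2 + 2 * t + 1 := by
    rw [Nat.choose_succ_succ' (t + 1) 1, Nat.choose_one_right, hchoose]; ring
  have hchoose₃ : (t + 3).choose 2 = t.choose 2 + 3 * t + 3 := by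
    rw [Nat.choose_succ_succ' (t + 2) 1, Nat.choose_one_right, hchoose₂]; ring
  have hnm : n ≤ m := by lia
  refine ⟨fun V _ G hV hG hm => hG.add_two_le_mvc hV hm (by lia) hm1, fun hexc => ?_,
    fun hexc => ⟨fun V _ G hV hG hm => hG.add_three_le_mvc hV hm hexc.2 (by lia), ?_⟩⟩
  · have hlow : ∀ H : SimpleGraph (Fin n), H.Connected → H.edgeSet.ncard = m → t + 2 ≤ H.mvc :=
      fun H hH hm => hH.add_two_le_mvc (Fintype.card_fin n) hm (by lia) hm1
    obtain hn2 | hn3 | hn5 : n = t + 2 ∨ (n = t + 3 ∨ n = t + 4) ∨ t + 5 ≤ n := by lia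
    · subst hn2
      exact SimpleGraph.exists_mvc_eq_card (by lia) hnm (by lia) hlow
    · have := SimpleGraph.le_ncard_edgeSet_tailGraph (n := n) (t := t) (by lia)
      exact (SimpleGraph.connected_tailGraph ht1 (by lia)).exists_mvc_eq
        (SimpleGraph.mvc_tailGraph_le ht1 (by lia)) hnm (by lia) hlow
    · have := SimpleGraph.le_ncard_edgeSet_earGraph (n := n) (t := t) ht1 (by lia)
      exact (SimpleGraph.connected_earGraph ht1 (by lia)).exists_mvc_eq
        (SimpleGraph.mvc_earGraph_le ht1 hn5) hnm (by lia) hlow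
  · have hlow : ∀ H : SimpleGraph (Fin n), H.Connected → H.edgeSet.ncard = m → t + 3 ≤ H.mvc :=
      fun H hH hm => hH.add_three_le_mvc (Fintype.card_fin n) hm hexc.2 (by lia)
    obtain ⟨hmeq, rfl | rfl⟩ := hexc
    · exact SimpleGraph.exists_mvc_eq_card (by lia) hnm (by lia) hlow
    · have := SimpleGraph.le_ncard_edgeSet_tailGraph (n := t + 4) (t := t + 1) (by lia)
      exact (SimpleGraph.connected_tailGraph (t := t + 1) (by lia) (by lia)).exists_mvc_eq
        (SimpleGraph.mvc_tailGraph_le (by lia) (by lia)) hnm (by rw [hchoose₂] at this; lia) hlow
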